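/- \emph{Pure types} are the closed expressions of the grammar $\tau ::= \mathbf 1 \mid \tau\times\tau \mid \tau\to\tau \mid \tau+\tau \mid X \mid \mathrm{rec}\,X.\tau$, where $\mathrm{rec}\,X$ binds the type variable $X$. A \emph{cpo} is a poset with a least element and suprema of all (nonempty) directed subsets; an element $d$ of a cpo is \emph{finite} if, for every directed $D$ with $d\le\bigvee D$, there is $x\in D$ with $d\le x$; and $\uparrow d=\{x\mid d\le x\}$. A type expression with $n$ free type variables is interpreted as a functor of $n$ arguments on the category of cpos and embedding-projection pairs: $[\![\mathbf 1]\!]=\{\bot\le\top\}$; $[\![\sigma\times\tau]\!]$ is the product with the component-wise order; $[\![\sigma\to\tau]\!]$ is the set of Scott-continuous functions with the pointwise order; $[\![\sigma+\tau]\!]$ is the disjoint union with a new least element; and $[\![\mathrm{rec}\,X.\tau]\!]$ is the colimit of the $\omega$-chain $\{\bot\}\to G(\{\bot\})\to G^2(\{\bot\})\to\cdots$ obtained by iterating $G=[\![\tau]\!]$ in its argument $X$, with the canonical isomorphism $\mathrm{unfold}:[\![\mathrm{rec}\,X.\tau]\!]\to[\![\tau[\mathrm{rec}\,X.\tau/X]]\!]$.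 So each pure type $\tau$ is interpreted as a cpo $[\![\tau]\!]$ (in fact a Scott domain). For pure types $\tau$, the sets $\mathcal L^\wedge(\tau)$ of formulae are inductively generated as follows: $\top,\bot\in\mathcal L^\wedge(\tau)$; if $\varphi,\psi\in\mathcal L^\wedge(\tau)$ then $\varphi\wedge\psi\in\mathcal L^\wedge(\tau)$; $\langle\rangle\in\mathcal L^\wedge(\mathbf 1)$; if $\varphi\in\mathcal L^\wedge(\tau_i)$ then $\langle\pi_i\rangle\varphi\in\mathcal L^\wedge(\tau_1\times\tau_2)$ and $\langle\mathrm{in}_i\rangle\varphi\in\mathcal L^\wedge(\tau_1+\tau_2)$ $(i=1,2)$; if $\varphi\in\mathcal L^\wedge(\tau[\mathrm{rec}\,X.\tau/X])$ then $\langle\mathrm{fold}\rangle\varphi\in\mathcal L^\wedge(\mathrm{rec}\,X.\tau)$; if $\psi\in\mathcal L^\wedge(\sigma)$ and $\varphi\in\mathcal L^\wedge(\tau)$ then $\psi\Vdash\varphi\in\mathcal L^\wedge(\sigma\to\tau)$. Each $\varphi\in\mathcal L^\wedge(\tau)$ defines a set $[\![\varphi]\!]\subseteq[\![\tau]\!]$: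 $[\![\top]\!]=[\![\tau]\!]$, $[\![\bot]\!]=\emptyset$, $[\![\varphi\wedge\psi]\!]=[\![\varphi]\!]\cap[\![\psi]\!]$, $[\![\langle\rangle]\!]=\{\top\}$, $[\![\langle\pi_i\rangle\varphi]\!]=\{x\mid\pi_i(x)\in[\![\varphi]\!]\}$, $[\![\langle\mathrm{in}_i\rangle\varphi]\!]=\{\mathrm{in}_i(x)\mid x\in[\![\varphi]\!]\}$, $[\![\langle\mathrm{fold}\rangle\varphi]\!]=\{x\mid\mathrm{unfold}(x)\in[\![\varphi]\!]\}$, and $[\![\psi\Vdash\varphi]\!]=\{f\mid\forall x\in[\![\psi]\!],\ f(x)\in[\![\varphi]\!]\}$. \textbf{Proposition.} Let $\tau$ be a pure type. (1) For every $\delta\in\mathcal L^\wedge(\tau)$ with $[\![\delta]\!]\neq\emptyset$ there is a finite $d\in[\![\tau]\!]$ with $[\![\delta]\!]=\uparrow d$. (2) Conversely, for every finite $d\in[\![\tau]\!]$ there is $\delta\in\mathcal L^\wedge(\tau)$ with $\uparrow d=[\![\delta]\!]$. -/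

import Mathlib

open CategoryTheory

attribute [-instance] CategoryTheory.catToReflQuiver

namespace DomainLogic

/-! ## Complete partial orders and Scott-continuous functions -/

/-- A bundled cpo: a partial order with a least element and with suprema of all directed subsets. -/
structure Cpo : Type 1 where
  carrier : Type
  [cpo : CompletePartialOrder carrier]

instance : CoeSort Cpo Type := ⟨Cpo.carrier⟩

instance (X : Cpo) : CompletePartialOrder X := X.cpo

/-- A partial order with a least element and suprema of nonempty directed sets is a cpo. -/
noncomputable abbrev cpoOfExists (α : Type) [PartialOrder α] (b : α) (hb : ∀ x, b ≤ x)
    (h : ∀ D : Set α, D.Nonempty → DirectedOn (· ≤ ·) D → ∃ s, IsLUB D s) :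
    CompletePartialOrder α :=
  letI : SupSet α := ⟨fun D => @Classical.epsilon α ⟨b⟩ (fun s => IsLUB D s)⟩
  { (inferInstance : PartialOrder α) with
    bot := b
    bot_le := hb
    lubOfDirected := fun D hD => by
      have hex : ∃ s, IsLUB D s := by
        rcases D.eq_empty_or_nonempty with rfl | hne
        · exact ⟨b, by simp, fun x _ => hb x⟩
        · exact h D hne hD
      exact Classical.epsilon_spec hex }

/-- Scott-continuous functions, i.e. those that preserve directed suprema. -/
structure ScottMap (X Y : Type) [Preorder X] [Preorder Y] where
  toFun : X → Y
  cont : ScottContinuous toFun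

namespace ScottMap

variable {X Y Z : Type}

instance [Preorder X] [Preorder Y] : FunLike (ScottMap X Y) X Y where
  coe := toFun
  coe_injective := by rintro ⟨f, _⟩ ⟨g, _⟩ h; cases h; rfl

@[ext] theorem ext [Preorder X] [Preorder Y] {f g : ScottMap X Y} (h : ∀ x, f x = g x) : f = g :=
  DFunLike.ext _ _ h

theorem mono [Preorder X] [Preorder Y] (f : ScottMap X Y) : Monotone f := f.cont.monotone

@[simp] theorem mk_apply [Preorder X] [Preorder Y] (f : X → Y) (h) (x : X) :
    (ScottMap.mk f h) x = f x := rfl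

/-- The pointwise order. -/
instance [Preorder X] [PartialOrder Y] : PartialOrder (ScottMap X Y) where
  le f g := ∀ x, f x ≤ g x
  le_refl _ _ := le_rfl
  le_trans _ _ _ h h' x := (h x).trans (h' x)
  le_antisymm _ _ h h' := ext fun x => le_antisymm (h x) (h' x)

theorem le_def [Preorder X] [PartialOrder Y] {f g : ScottMap X Y} :
    f ≤ g ↔ ∀ x, f x ≤ g x := Iff.rfl

theorem le_apply [Preorder X] [PartialOrder Y] {f g : ScottMap X Y} (h : f ≤ g) (x : X) :
    f x ≤ g x := h x

/-- The identity. -/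
def id (X : Type) [Preorder X] : ScottMap X X := ⟨fun x => x, ScottContinuous.id⟩

/-- Composition, `(g.comp f) x = g (f x)`. -/
def comp [Preorder X] [Preorder Y] [Preorder Z] (g : ScottMap Y Z) (f : ScottMap X Y) :
    ScottMap X Z := ⟨fun x => g (f x), ScottContinuous.comp (f := f) (g := g) f.cont g.cont⟩

@[simp] theorem id_apply [Preorder X] (x : X) : id X x = x := rfl

@[simp] theorem comp_apply [Preorder X] [Preorder Y] [Preorder Z] (g : ScottMap Y Z)
    (f : ScottMap X Y) (x : X) : g.comp f x = g (f x) := rfl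

theorem directed_image [Preorder X] [Preorder Y] {f : X → Y} (hf : Monotone f) {D : Set X}
    (hD : DirectedOn (· ≤ ·) D) : DirectedOn (· ≤ ·) (f '' D) := by
  rintro _ ⟨x, hx, rfl⟩ _ ⟨y, hy, rfl⟩
  obtain ⟨z, hz, h1, h2⟩ := hD x hx y hy
  exact ⟨_, ⟨z, hz, rfl⟩, hf h1, hf h2⟩

theorem scott_of [Preorder X] [Preorder Y] {f : X → Y} (hf : Monotone f)
    (h : ∀ (D : Set X) (s : X), D.Nonempty → DirectedOn (· ≤ ·) D → IsLUB D s →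
      ∀ u, (∀ x ∈ D, f x ≤ u) → f s ≤ u) : ScottContinuous f := by
  intro D hne hD s hs
  refine ⟨?_, fun u hu => h D s hne hD hs u fun x hx => hu ⟨x, hx, rfl⟩⟩
  rintro _ ⟨x, hx, rfl⟩
  exact hf (hs.1 hx)

theorem map_le [Preorder X] [Preorder Y] (f : ScottMap X Y) {D : Set X} {s : X}
    (hne : D.Nonempty) (hD : DirectedOn (· ≤ ·) D) (hs : IsLUB D s) {u : Y}
    (hu : ∀ x ∈ D, f x ≤ u) : f s ≤ u :=
  (f.cont hne hD hs).2 (by rintro _ ⟨x, hx, rfl⟩; exact hu x hx)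

/-- The pointwise supremum of a directed set of Scott-continuous functions. -/
noncomputable def sup [Preorder X] [CompletePartialOrder Y] (D : Set (ScottMap X Y))
    (hD : DirectedOn (· ≤ ·) D) : ScottMap X Y :=
  have hdir : ∀ x, DirectedOn (· ≤ ·) ((fun f : ScottMap X Y => f x) '' D) := fun x =>
    directed_image (fun _ _ h => le_apply h x) hD
  ⟨fun x => sSup ((fun f : ScottMap X Y => f x) '' D), scott_of
    (fun x y hxy => (hdir x).sSup_le (by
      rintro _ ⟨f, hf, rfl⟩
      exact (f.mono hxy).trans ((hdir y).le_sSup ⟨f, hf, rfl⟩)))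
    (fun E s hne hE hs u hu => (hdir s).sSup_le (by
      rintro _ ⟨f, hf, rfl⟩
      exact f.map_le hne hE hs fun x hx => ((hdir x).le_sSup ⟨f, hf, rfl⟩).trans (hu x hx)))⟩

theorem isLUB_sup_apply [Preorder X] [CompletePartialOrder Y] (D : Set (ScottMap X Y))
    (hD : DirectedOn (· ≤ ·) D) (x : X) :
    IsLUB ((fun f : ScottMap X Y => f x) '' D) (sup D hD x) :=
  (directed_image (fun _ _ h => le_apply h x) hD).isLUB_sSup

theorem isLUB_sup [Preorder X] [CompletePartialOrder Y] (D : Set (ScottMap X Y))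
    (hD : DirectedOn (· ≤ ·) D) : IsLUB D (sup D hD) :=
  ⟨fun f hf x => (isLUB_sup_apply D hD x).1 ⟨f, hf, rfl⟩,
    fun g hg x => (isLUB_sup_apply D hD x).2 (by rintro _ ⟨f, hf, rfl⟩; exact hg hf x)⟩

/-- Directed suprema of Scott-continuous functions are computed pointwise. -/
theorem isLUB_apply [Preorder X] [CompletePartialOrder Y] {D : Set (ScottMap X Y)}
    (hD : DirectedOn (· ≤ ·) D) {s : ScottMap X Y} (hs : IsLUB D s) (x : X) :
    IsLUB ((fun f : ScottMap X Y => f x) '' D) (s x) := by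
  rw [hs.unique (isLUB_sup D hD)]
  exact isLUB_sup_apply D hD x

noncomputable instance [Preorder X] [CompletePartialOrder Y] :
    CompletePartialOrder (ScottMap X Y) :=
  cpoOfExists _ ⟨fun _ => ⊥, ScottContinuous.const ⊥⟩ (fun _ _ => bot_le)
    (fun D _ hD => ⟨_, isLUB_sup D hD⟩)

end ScottMap

/-! ## Embedding-projection pairs -/

/-- An embedding-projection pair from `X` to `Y`: Scott-continuous `emb : X → Y` and
`proj : Y → X` with `proj ∘ emb = id` and `emb ∘ proj ≤ id`. -/
structure EP (X Y : Cpo) where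
  emb : ScottMap X Y
  proj : ScottMap Y X
  proj_emb : ∀ x, proj (emb x) = x
  emb_proj : ∀ y, emb (proj y) ≤ y

/-- The embedding is determined by the projection. -/
theorem EP.ext_proj {X Y : Cpo} {f g : EP X Y} (h : ∀ y, f.proj y = g.proj y) : f = g := by
  have key : ∀ (f g : EP X Y), (∀ y, f.proj y = g.proj y) → ∀ x, f.emb x ≤ g.emb x := by
    intro f g h x
    calc f.emb x = f.emb (g.proj (g.emb x)) := by rw [g.proj_emb]
      _ = f.emb (f.proj (g.emb x)) := by rw [h]
      _ ≤ g.emb x := f.emb_proj _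
  have h1 : f.emb = g.emb :=
    ScottMap.ext fun x => le_antisymm (key f g h x) (key g f (fun y => (h y).symm) x)
  have h2 : f.proj = g.proj := ScottMap.ext h
  cases f; cases g; cases h1; cases h2; rfl

/-- The category whose objects are cpos and whose morphisms are embedding-projection pairs. -/
instance : Category Cpo where
  Hom := EP
  id X := ⟨.id X, .id X, fun _ => rfl, fun _ => le_rfl⟩
  comp f g := ⟨g.emb.comp f.emb, f.proj.comp g.proj,
    fun x => by simp [g.proj_emb, f.proj_emb],
    fun y => (g.emb.mono (f.emb_proj _)).trans (g.emb_proj y)⟩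

theorem ep_ext {X Y : Cpo} {f g : X ⟶ Y} (h : ∀ y, f.proj y = g.proj y) : f = g := EP.ext_proj h

@[simp] theorem id_proj (X : Cpo) (x : X) : EP.proj (𝟙 X) x = x := rfl
@[simp] theorem id_emb (X : Cpo) (x : X) : EP.emb (𝟙 X) x = x := rfl
@[simp] theorem comp_proj {X Y Z : Cpo} (f : X ⟶ Y) (g : Y ⟶ Z) (z : Z) :
    (f ≫ g).proj z = f.proj (g.proj z) := rfl
@[simp] theorem comp_emb {X Y Z : Cpo} (f : X ⟶ Y) (g : Y ⟶ Z) (x : X) :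
    (f ≫ g).emb x = g.emb (f.emb x) := rfl

theorem proj_bot {X Y : Cpo} (f : X ⟶ Y) : f.proj ⊥ = ⊥ :=
  le_bot_iff.1 ((f.proj.mono bot_le).trans_eq (f.proj_emb ⊥))

/-! ## The functors that interpret the type constructors -/

/-- The one-point cpo. -/
noncomputable def one : Cpo :=
  letI := cpoOfExists Unit () (fun _ => le_rfl) (fun _ _ _ => ⟨(), fun _ _ => le_rfl, fun _ _ => le_rfl⟩)
  ⟨Unit⟩

instance : Subsingleton one := inferInstanceAs (Subsingleton Unit)

/-- The one-point cpo is initial for embedding-projection pairs. -/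
noncomputable def fromOne (X : Cpo) : one ⟶ X :=
  ⟨⟨fun _ => ⊥, ScottContinuous.const ⊥⟩, ⟨fun _ => ⊥, ScottContinuous.const ⊥⟩,
    fun _ => Subsingleton.elim _ _, fun _ => bot_le⟩

theorem fromOne_unique {X : Cpo} (f g : one ⟶ X) : f = g := ep_ext fun _ => Subsingleton.elim _ _

/-- The two-point cpo `{⊥, ⊤}` (as `Prop`, with `⊥ = False` and `⊤ = True`). -/
def two : Cpo := ⟨Prop⟩

/-- Binary products, with the component-wise order. -/
noncomputable def prodObj (X Y : Cpo) : Cpo :=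
  letI : CompletePartialOrder (X × Y) := cpoOfExists (X × Y) (⊥, ⊥) (fun _ => ⟨bot_le, bot_le⟩)
    (fun D _ hD => ⟨(sSup (Prod.fst '' D), sSup (Prod.snd '' D)), isLUB_prod.2
      ⟨(ScottMap.directed_image monotone_fst hD).isLUB_sSup,
        (ScottMap.directed_image monotone_snd hD).isLUB_sSup⟩⟩)
  ⟨X × Y⟩

/-- The action of the product on a pair of Scott-continuous functions. -/
def prodMap {X X' Y Y' : Cpo} (f : ScottMap X X') (g : ScottMap Y Y') :
    ScottMap (prodObj X Y) (prodObj X' Y') where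
  toFun p := (f p.1, g p.2)
  cont := ScottContinuous.prodMk
    (ScottContinuous.comp (f := Prod.fst) (g := f) ScottContinuous.fst f.cont)
    (ScottContinuous.comp (f := Prod.snd) (g := g) ScottContinuous.snd g.cont)

/-- Binary products as a functor on embedding-projection pairs. -/
noncomputable def prodF : Cpo × Cpo ⥤ Cpo where
  obj P := prodObj P.1 P.2
  map f := ⟨prodMap f.1.emb f.2.emb, prodMap f.1.proj f.2.proj,
    fun _ => Prod.ext (f.1.proj_emb _) (f.2.proj_emb _),
    fun _ => ⟨f.1.emb_proj _, f.2.emb_proj _⟩⟩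
  map_id _ := rfl
  map_comp _ _ := rfl

/-- The cpo of Scott-continuous functions, with the pointwise order. -/
noncomputable def arrowObj (X Y : Cpo) : Cpo := ⟨ScottMap X Y⟩

/-- The mixed-variance action of the function space: `h ↦ g ∘ h ∘ f`. -/
def arrowMap {X X' Y Y' : Cpo} (f : ScottMap X' X) (g : ScottMap Y Y') :
    ScottMap (arrowObj X Y) (arrowObj X' Y') where
  toFun h := g.comp (ScottMap.comp h f)
  cont := by
    refine ScottMap.scott_of (fun h h' hh x => g.mono (ScottMap.le_apply hh (f x))) ?_
    intro D s hne hD hs u hu x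
    refine g.map_le (D := (fun h : ScottMap X Y => h (f x)) '' D) (hne.image _)
      (ScottMap.directed_image (fun _ _ h => ScottMap.le_apply h (f x)) hD) (ScottMap.isLUB_apply hD hs (f x)) ?_
    rintro _ ⟨h, hh, rfl⟩
    exact hu h hh x

/-- The function space as a (covariant) functor on embedding-projection pairs. -/
noncomputable def arrowF : Cpo × Cpo ⥤ Cpo where
  obj P := arrowObj P.1 P.2
  map f := ⟨arrowMap f.1.proj f.2.emb, arrowMap f.1.emb f.2.proj,
    fun h => ScottMap.ext fun x => by
      change f.2.proj (f.2.emb (ScottMap.toFun h (f.1.proj (f.1.emb x)))) = ScottMap.toFun h x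
      rw [f.2.proj_emb, f.1.proj_emb],
    fun h x => (f.2.emb_proj _).trans (ScottMap.mono h (f.1.emb_proj x))⟩
  map_id _ := rfl
  map_comp _ _ := rfl

theorem sum_exists_lub (X Y : Cpo) (D : Set (WithBot (X ⊕ Y))) (hD : DirectedOn (· ≤ ·) D) :
    ∃ s, IsLUB D s := by
  by_cases hl : ∃ x : X, ((Sum.inl x : X ⊕ Y) : WithBot (X ⊕ Y)) ∈ D
  · obtain ⟨x₀, hx₀⟩ := hl
    have hdir : DirectedOn (· ≤ ·) {x : X | ((Sum.inl x : X ⊕ Y) : WithBot (X ⊕ Y)) ∈ D} := by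
      intro a ha b hb
      obtain ⟨c, hc, hac, hbc⟩ := hD _ ha _ hb
      induction c using WithBot.recBotCoe with
      | bot => simp at hac
      | coe c =>
        rcases c with c | c
        · exact ⟨c, hc, by simpa using hac, by simpa using hbc⟩
        · simp at hac
    refine ⟨((Sum.inl (sSup {x : X | ((Sum.inl x : X ⊕ Y) : WithBot (X ⊕ Y)) ∈ D}) : X ⊕ Y) :
      WithBot (X ⊕ Y)), ?_, ?_⟩
    · intro c hc
      obtain ⟨e, he, h1, h2⟩ := hD _ hx₀ _ hc
      induction c using WithBot.recBotCoe with
      | bot => exact bot_le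
      | coe c =>
        induction e using WithBot.recBotCoe with
        | bot => simp at h1
        | coe e =>
          rcases e with e | e
          · rcases c with c | c
            · simpa using hdir.le_sSup hc
            · simp at h2
          · simp at h1
    · intro u hu
      induction u using WithBot.recBotCoe with
      | bot => simpa using hu hx₀
      | coe u =>
        rcases u with u | u
        · have : sSup {x : X | ((Sum.inl x : X ⊕ Y) : WithBot (X ⊕ Y)) ∈ D} ≤ u :=
            hdir.sSup_le fun x hx => by simpa using hu hx
          simpa using this
        · simpa using hu hx₀
  · by_cases hr : ∃ y : Y, ((Sum.inr y : X ⊕ Y) : WithBot (X ⊕ Y)) ∈ D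
    · obtain ⟨y₀, hy₀⟩ := hr
      have hdir : DirectedOn (· ≤ ·) {y : Y | ((Sum.inr y : X ⊕ Y) : WithBot (X ⊕ Y)) ∈ D} := by
        intro a ha b hb
        obtain ⟨c, hc, hac, hbc⟩ := hD _ ha _ hb
        induction c using WithBot.recBotCoe with
        | bot => simp at hac
        | coe c =>
          rcases c with c | c
          · simp at hac
          · exact ⟨c, hc, by simpa using hac, by simpa using hbc⟩
      refine ⟨((Sum.inr (sSup {y : Y | ((Sum.inr y : X ⊕ Y) : WithBot (X ⊕ Y)) ∈ D}) : X ⊕ Y) :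
        WithBot (X ⊕ Y)), ?_, ?_⟩
      · intro c hc
        induction c using WithBot.recBotCoe with
        | bot => exact bot_le
        | coe c =>
          rcases c with c | c
          · exact absurd ⟨c, hc⟩ hl
          · simpa using hdir.le_sSup hc
      · intro u hu
        induction u using WithBot.recBotCoe with
        | bot => simpa using hu hy₀
        | coe u =>
          rcases u with u | u
          · simpa using hu hy₀
          · have : sSup {y : Y | ((Sum.inr y : X ⊕ Y) : WithBot (X ⊕ Y)) ∈ D} ≤ u :=
              hdir.sSup_le fun x hx => by simpa using hu hx
            simpa using this
    · refine ⟨⊥, ?_, fun _ _ => bot_le⟩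
      intro c hc
      induction c using WithBot.recBotCoe with
      | bot => exact bot_le
      | coe c =>
        rcases c with c | c
        · exact absurd ⟨c, hc⟩ hl
        · exact absurd ⟨c, hc⟩ hr

/-- The weak sum: the disjoint union of `X` and `Y`, with a new least element. -/
noncomputable def sumObj (X Y : Cpo) : Cpo :=
  letI : CompletePartialOrder (WithBot (X ⊕ Y)) := cpoOfExists _ ⊥ (fun _ => bot_le)
    (fun D _ hD => sum_exists_lub X Y D hD)
  ⟨WithBot (X ⊕ Y)⟩

/-- The first injection into the weak sum. -/
def sumInl {X Y : Cpo} (x : X) : sumObj X Y := ((Sum.inl x : X ⊕ Y) : WithBot (X ⊕ Y))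

/-- The second injection into the weak sum. -/
def sumInr {X Y : Cpo} (y : Y) : sumObj X Y := ((Sum.inr y : X ⊕ Y) : WithBot (X ⊕ Y))

theorem sum_map_cont {X X' Y Y' : Cpo} (f : ScottMap X X') (g : ScottMap Y Y') :
    ScottContinuous (WithBot.map (Sum.map f g)) := by
  have hmono : Monotone (WithBot.map (Sum.map f g)) :=
    Monotone.withBot_map fun a b h => by
      rcases a with a | a <;> rcases b with b | b
      · simpa using f.mono (by simpa using h)
      · simp at h
      · simp at h
      · simpa using g.mono (by simpa using h)
  refine ScottMap.scott_of hmono ?_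
  intro D s hne hD hs u hu
  induction s using WithBot.recBotCoe with
  | bot => exact bot_le
  | coe s =>
    rcases s with s | s
    · have hD' : ∀ c ∈ D, c = ⊥ ∨ ∃ x : X, c = ((Sum.inl x : X ⊕ Y) : WithBot (X ⊕ Y)) := by
        intro c hc
        have := hs.1 hc
        induction c using WithBot.recBotCoe with
        | bot => exact Or.inl rfl
        | coe c =>
          rcases c with c | c
          · exact Or.inr ⟨c, rfl⟩
          · simp at this
      have hex : ∃ x : X, ((Sum.inl x : X ⊕ Y) : WithBot (X ⊕ Y)) ∈ D := by
        by_contra hno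
        have : ((Sum.inl s : X ⊕ Y) : WithBot (X ⊕ Y)) ≤ ⊥ := hs.2 fun c hc => by
          rcases hD' c hc with rfl | ⟨x, rfl⟩
          · exact le_rfl
          · exact absurd ⟨x, hc⟩ hno
        simp at this
      have hlub : IsLUB {x : X | ((Sum.inl x : X ⊕ Y) : WithBot (X ⊕ Y)) ∈ D} s := by
        refine ⟨fun x hx => by simpa using hs.1 hx, fun v hv => ?_⟩
        have : ((Sum.inl s : X ⊕ Y) : WithBot (X ⊕ Y)) ≤ ((Sum.inl v : X ⊕ Y) : WithBot (X ⊕ Y)) :=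
          hs.2 fun c hc => by
            rcases hD' c hc with rfl | ⟨x, rfl⟩
            · exact bot_le
            · simpa using hv hc
        simpa using this
      have hdir : DirectedOn (· ≤ ·) {x : X | ((Sum.inl x : X ⊕ Y) : WithBot (X ⊕ Y)) ∈ D} := by
        intro a ha b hb
        obtain ⟨c, hc, hac, hbc⟩ := hD _ ha _ hb
        rcases hD' c hc with rfl | ⟨x, rfl⟩
        · simp at hac
        · exact ⟨x, hc, by simpa using hac, by simpa using hbc⟩
      obtain ⟨x₀, hx₀⟩ := hex
      have hu₀ := hu _ hx₀
      induction u using WithBot.recBotCoe with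
      | bot => simp at hu₀
      | coe u =>
        rcases u with u | u
        · have : f s ≤ u := f.map_le ⟨x₀, hx₀⟩ hdir hlub fun x hx => by simpa using hu _ hx
          simpa using this
        · simp at hu₀
    · have hD' : ∀ c ∈ D, c = ⊥ ∨ ∃ y : Y, c = ((Sum.inr y : X ⊕ Y) : WithBot (X ⊕ Y)) := by
        intro c hc
        have := hs.1 hc
        induction c using WithBot.recBotCoe with
        | bot => exact Or.inl rfl
        | coe c =>
          rcases c with c | c
          · simp at this
          · exact Or.inr ⟨c, rfl⟩
      have hex : ∃ y : Y, ((Sum.inr y : X ⊕ Y) : WithBot (X ⊕ Y)) ∈ D := by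
        by_contra hno
        have : ((Sum.inr s : X ⊕ Y) : WithBot (X ⊕ Y)) ≤ ⊥ := hs.2 fun c hc => by
          rcases hD' c hc with rfl | ⟨x, rfl⟩
          · exact le_rfl
          · exact absurd ⟨x, hc⟩ hno
        simp at this
      have hlub : IsLUB {y : Y | ((Sum.inr y : X ⊕ Y) : WithBot (X ⊕ Y)) ∈ D} s := by
        refine ⟨fun x hx => by simpa using hs.1 hx, fun v hv => ?_⟩
        have : ((Sum.inr s : X ⊕ Y) : WithBot (X ⊕ Y)) ≤ ((Sum.inr v : X ⊕ Y) : WithBot (X ⊕ Y)) :=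
          hs.2 fun c hc => by
            rcases hD' c hc with rfl | ⟨x, rfl⟩
            · exact bot_le
            · simpa using hv hc
        simpa using this
      have hdir : DirectedOn (· ≤ ·) {y : Y | ((Sum.inr y : X ⊕ Y) : WithBot (X ⊕ Y)) ∈ D} := by
        intro a ha b hb
        obtain ⟨c, hc, hac, hbc⟩ := hD _ ha _ hb
        rcases hD' c hc with rfl | ⟨x, rfl⟩
        · simp at hac
        · exact ⟨x, hc, by simpa using hac, by simpa using hbc⟩
      obtain ⟨x₀, hx₀⟩ := hex
      have hu₀ := hu _ hx₀
      induction u using WithBot.recBotCoe with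
      | bot => simp at hu₀
      | coe u =>
        rcases u with u | u
        · simp at hu₀
        · have : g s ≤ u := g.map_le ⟨x₀, hx₀⟩ hdir hlub fun x hx => by simpa using hu _ hx
          simpa using this

/-- The action of the weak sum on a pair of Scott-continuous functions. -/
def sumMap {X X' Y Y' : Cpo} (f : ScottMap X X') (g : ScottMap Y Y') :
    ScottMap (sumObj X Y) (sumObj X' Y') where
  toFun := WithBot.map (Sum.map f g)
  cont := sum_map_cont f g

/-- The weak sum as a functor on embedding-projection pairs. -/
noncomputable def sumF : Cpo × Cpo ⥤ Cpo where
  obj P := sumObj P.1 P.2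
  map f := ⟨sumMap f.1.emb f.2.emb, sumMap f.1.proj f.2.proj,
    fun p => by
      change WithBot.map _ (WithBot.map _ p) = p
      induction p using WithBot.recBotCoe with
      | bot => rfl
      | coe p => rcases p with p | p <;> simp [EP.proj_emb],
    fun p => by
      change WithBot.map _ (WithBot.map _ p) ≤ p
      induction p using WithBot.recBotCoe with
      | bot => exact bot_le
      | coe p => rcases p with p | p <;> simp [EP.emb_proj]⟩
  map_id P := ep_ext fun p => by
    change WithBot.map _ p = p
    induction p using WithBot.recBotCoe with
    | bot => rfl
    | coe p => rcases p with p | p <;> rfl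
  map_comp f g := ep_ext fun p => by
    change WithBot.map _ p = WithBot.map _ (WithBot.map _ p)
    induction p using WithBot.recBotCoe with
    | bot => rfl
    | coe p => rcases p with p | p <;> rfl

/-! ## Colimits of ω-chains of embedding-projection pairs -/

section Bilimit

variable (F : ℕ ⥤ Cpo)

/-- Compatible sequences: the limit of the projections of the chain `F`. -/
def BilimType : Type :=
  {x : ∀ n, F.obj n // ∀ i j (h : i ≤ j), (F.map (homOfLE h)).proj (x j) = x i}

instance : PartialOrder (BilimType F) := inferInstanceAs (PartialOrder (Subtype _))

variable {F}

theorem bilim_directed {D : Set (BilimType F)} (hD : DirectedOn (· ≤ ·) D) (n : ℕ) :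
    DirectedOn (· ≤ ·) ((fun x : BilimType F => x.1 n) '' D) :=
  ScottMap.directed_image (fun x y h => (show ∀ n, x.1 n ≤ y.1 n from h) n) hD

/-- The pointwise supremum of a directed set of compatible sequences. -/
noncomputable def bilimSup (D : Set (BilimType F)) (hne : D.Nonempty)
    (hD : DirectedOn (· ≤ ·) D) : BilimType F :=
  ⟨fun n => sSup ((fun x : BilimType F => x.1 n) '' D), fun i j h => by
    have h1 := (F.map (homOfLE h)).proj.cont (hne.image _) (bilim_directed hD j)
      (bilim_directed hD j).isLUB_sSup
    rw [Set.image_image] at h1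
    have h2 : (fun x : BilimType F => (F.map (homOfLE h)).proj (x.1 j)) = fun x => x.1 i :=
      funext fun x => x.2 i j h
    have h3 : IsLUB ((fun x : BilimType F => (F.map (homOfLE h)).proj (x.1 j)) '' D)
      ((F.map (homOfLE h)).proj (sSup ((fun x : BilimType F => x.1 j) '' D))) := h1
    rw [h2] at h3
    exact h3.unique (bilim_directed hD i).isLUB_sSup⟩

theorem bilimSup_isLUB (D : Set (BilimType F)) (hne : D.Nonempty) (hD : DirectedOn (· ≤ ·) D) :
    IsLUB D (bilimSup D hne hD) :=
  ⟨fun x hx n => (bilim_directed hD n).le_sSup ⟨x, hx, rfl⟩,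
    fun u hu n => (bilim_directed hD n).sSup_le (by rintro _ ⟨x, hx, rfl⟩; exact hu hx n)⟩

theorem bilim_isLUB_apply {D : Set (BilimType F)} (hne : D.Nonempty) (hD : DirectedOn (· ≤ ·) D)
    {s : BilimType F} (hs : IsLUB D s) (n : ℕ) :
    IsLUB ((fun x : BilimType F => x.1 n) '' D) (s.1 n) := by
  rw [hs.unique (bilimSup_isLUB D hne hD)]
  exact (bilim_directed hD n).isLUB_sSup

variable (F)

/-- The limit of the projections of `F`, with the pointwise order. -/
noncomputable def bilimObj : Cpo :=
  letI := cpoOfExists (BilimType F) ⟨fun _ => ⊥, fun _ _ _ => proj_bot _⟩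
    (fun _ _ => bot_le) (fun D hne hD => ⟨_, bilimSup_isLUB D hne hD⟩)
  ⟨BilimType F⟩

variable {F}

theorem through_indep {n m k l : ℕ} (hn : n ≤ k) (hm : m ≤ k) (hk : k ≤ l) (x : F.obj n) :
    (F.map (homOfLE (hm.trans hk))).proj ((F.map (homOfLE (hn.trans hk))).emb x) =
      (F.map (homOfLE hm)).proj ((F.map (homOfLE hn)).emb x) := by
  rw [← homOfLE_comp hm hk, ← homOfLE_comp hn hk, F.map_comp, F.map_comp, comp_proj, comp_emb,
    EP.proj_emb]

/-- Embed `F n` into `F k` and project to `F m`; this does not depend on `k ≥ n, m`. -/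
def through (n m : ℕ) (x : F.obj n) : F.obj m :=
  (F.map (homOfLE (le_max_right n m))).proj ((F.map (homOfLE (le_max_left n m))).emb x)

theorem through_eq {n m k : ℕ} (hn : n ≤ k) (hm : m ≤ k) (x : F.obj n) :
    through n m x = (F.map (homOfLE hm)).proj ((F.map (homOfLE hn)).emb x) :=
  (through_indep (le_max_left n m) (le_max_right n m) (max_le hn hm) x).symm

variable (F)

/-- The embedding-projection pair from `F n` to the limit: its projection part is the `n`-th
coordinate. -/
noncomputable def bilimIn (n : ℕ) : F.obj n ⟶ bilimObj F where
  emb := ⟨fun x => ⟨fun m => through n m x, fun i j h => by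
      change (F.map (homOfLE h)).proj (through n j x) = through n i x
      rw [through_eq (le_max_left n j) (h.trans (le_max_right n j)), through,
        ← homOfLE_comp h (le_max_right n j), F.map_comp, comp_proj]⟩,
    ScottMap.scott_of (fun x y h m => (EP.proj _).mono ((EP.emb _).mono h))
      (fun D s hne hD hs u hu m =>
        ((F.map (homOfLE (le_max_right n m))).proj.comp
          (F.map (homOfLE (le_max_left n m))).emb).map_le hne hD hs fun x hx => hu x hx m)⟩
  proj := ⟨fun x => x.1 n, ScottMap.scott_of (fun _ _ h => h n) fun D s hne hD hs u hu =>
      (bilim_isLUB_apply hne hD hs n).2 (by rintro _ ⟨x, hx, rfl⟩; exact hu x hx)⟩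
  proj_emb x := by
    change through n n x = x
    rw [through_eq le_rfl le_rfl, EP.proj_emb]
  emb_proj x m := by
    change through n m (x.1 n) ≤ x.1 m
    rw [through, ← x.2 n _ (le_max_left n m), ← x.2 m _ (le_max_right n m)]
    exact (EP.proj _).mono (EP.emb_proj _ _)

@[simp] theorem bilimIn_proj (n : ℕ) (x : bilimObj F) : (bilimIn F n).proj x = x.1 n := rfl

/-- The cocone of the `bilimIn F n`. -/
noncomputable def bilimCocone : Limits.Cocone F where
  pt := bilimObj F
  ι :=
    { app := bilimIn F
      naturality := fun i j f => ep_ext fun x => x.2 i j (leOfHom f) }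

variable {F}

/-- The components of a cocone. -/
def leg (s : Limits.Cocone F) (n : ℕ) : F.obj n ⟶ s.pt := s.ι.app n

theorem leg_w (s : Limits.Cocone F) {i j : ℕ} (h : i ≤ j) :
    F.map (homOfLE h) ≫ leg s j = leg s i := s.w (homOfLE h)

theorem cocone_proj (s : Limits.Cocone F) {i j : ℕ} (h : i ≤ j) (y : s.pt) :
    (F.map (homOfLE h)).proj ((leg s j).proj y) = (leg s i).proj y := by
  rw [← comp_proj, leg_w]

theorem cocone_emb_mono (s : Limits.Cocone F) (x : BilimType F) :
    Monotone fun n => (leg s n).emb (x.1 n) := by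
  intro i j h
  change (leg s i).emb (x.1 i) ≤ (leg s j).emb (x.1 j)
  rw [← leg_w s h, comp_emb, ← x.2 i j h]
  exact (EP.emb _).mono (EP.emb_proj _ _)

theorem cocone_emb_directed (s : Limits.Cocone F) (x : BilimType F) :
    DirectedOn (· ≤ ·) (Set.range fun n => (leg s n).emb (x.1 n)) :=
  (cocone_emb_mono s x).directed_le.directedOn_range

/-- The mediating morphism to a cocone `τ`: its embedding part is `x ↦ ⨆ n, τₙ (xₙ)`. -/
noncomputable def bilimDesc (s : Limits.Cocone F) : bilimObj F ⟶ s.pt where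
  emb := ⟨fun x => sSup (Set.range fun n => (leg s n).emb (x.1 n)), ScottMap.scott_of
    (fun x y h => (cocone_emb_directed s x).sSup_le (by
      rintro _ ⟨n, rfl⟩
      exact ((leg s n).emb.mono (h n)).trans ((cocone_emb_directed s y).le_sSup ⟨n, rfl⟩)))
    (fun D t hne hD ht u hu => (cocone_emb_directed s t).sSup_le (by
      rintro _ ⟨n, rfl⟩
      refine (leg s n).emb.map_le (hne.image _) (bilim_directed hD n)
        (bilim_isLUB_apply hne hD ht n) ?_
      rintro _ ⟨x, hx, rfl⟩
      exact ((cocone_emb_directed s x).le_sSup ⟨n, rfl⟩).trans (hu x hx)))⟩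
  proj := ⟨fun y => ⟨fun n => (leg s n).proj y, fun i j h => cocone_proj s h y⟩,
    ScottMap.scott_of (fun x y h n => (leg s n).proj.mono h)
      fun D t hne hD ht u hu n => (leg s n).proj.map_le hne hD ht fun x hx => hu x hx n⟩
  proj_emb x := by
    refine Subtype.ext (funext fun m => ?_)
    change (leg s m).proj (sSup (Set.range fun n => (leg s n).emb (x.1 n))) = x.1 m
    apply le_antisymm
    · refine (leg s m).proj.map_le (Set.range_nonempty _) (cocone_emb_directed s x)
        (cocone_emb_directed s x).isLUB_sSup ?_
      rintro _ ⟨n, rfl⟩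
      refine ((leg s m).proj.mono (cocone_emb_mono s x (le_max_left n m))).trans_eq ?_
      change (leg s m).proj ((leg s (max n m)).emb (x.1 (max n m))) = x.1 m
      rw [← cocone_proj s (le_max_right n m), EP.proj_emb, x.2]
    · calc x.1 m = (leg s m).proj ((leg s m).emb (x.1 m)) := ((leg s m).proj_emb _).symm
        _ ≤ _ := (leg s m).proj.mono ((cocone_emb_directed s x).le_sSup ⟨m, rfl⟩)
  emb_proj y := (cocone_emb_directed s _).sSup_le (by
    rintro _ ⟨n, rfl⟩
    exact (leg s n).emb_proj y)

variable (F)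

/-- The limit of the projections is a colimit of the chain of embedding-projection pairs. -/
noncomputable def bilimIsColimit : Limits.IsColimit (bilimCocone F) where
  desc := bilimDesc
  fac _ _ := ep_ext fun _ => rfl
  uniq s m hm := ep_ext fun y => Subtype.ext (funext fun n => by
    change (m.proj y).1 n = (s.ι.app n).proj y
    rw [← hm n]
    rfl)

end Bilimit

/-- Colimits of ω-chains as a functor. -/
noncomputable def bilim : (ℕ ⥤ Cpo) ⥤ Cpo where
  obj F := bilimObj F
  map {_ G} α := bilimDesc ⟨bilimObj G, α ≫ (bilimCocone G).ι⟩
  map_id _ := ep_ext fun _ => rfl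
  map_comp _ _ := ep_ext fun _ => rfl

/-! ## Solutions of recursive domain equations -/

section Fix

universe v u

variable {B : Type u} [Category.{v} B] (G : B × Cpo ⥤ Cpo)

/-- The iterates `G(b, -)ⁿ(1)`. -/
noncomputable def iterObj (b : B) (n : ℕ) : Cpo :=
  Nat.rec one (fun _ X => G.obj (b, X)) n

/-- The connecting morphisms `G(b, -)ⁿ(1) ⟶ G(b, -)ⁿ⁺¹(1)`. -/
noncomputable def iterStep (b : B) : ∀ n, iterObj G b n ⟶ iterObj G b (n + 1)
  | 0 => fromOne _
  | n + 1 => G.map (Prod.mkHom (𝟙 b) (iterStep b n))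

/-- The action of a morphism `f` of parameters on the iterates. -/
noncomputable def iterMap {b b' : B} (f : b ⟶ b') : ∀ n, iterObj G b n ⟶ iterObj G b' n
  | 0 => 𝟙 one
  | n + 1 => G.map (Prod.mkHom f (iterMap f n))

theorem iterMap_naturality {b b' : B} (f : b ⟶ b') (n : ℕ) :
    iterStep G b n ≫ iterMap G f (n + 1) = iterMap G f n ≫ iterStep G b' n := by
  induction n with
  | zero => exact fromOne_unique _ _
  | succ n ih =>
    change G.map _ ≫ G.map _ = G.map _ ≫ G.map _
    rw [← G.map_comp, ← G.map_comp]
    congr 1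
    refine Prod.ext ?_ ?_
    · simp
    · exact ih

/-- The ω-chain `1 ⟶ G(b, 1) ⟶ G(b, G(b, 1)) ⟶ ⋯`, as a functor of `b`. -/
noncomputable def iterChain : B ⥤ (ℕ ⥤ Cpo) where
  obj b := Functor.ofSequence (iterStep G b)
  map {b b'} f := NatTrans.ofSequence (F := Functor.ofSequence (iterStep G b))
    (G := Functor.ofSequence (iterStep G b')) (iterMap G f) (fun n => by
      rw [Functor.ofSequence_map_homOfLE_succ, Functor.ofSequence_map_homOfLE_succ]
      exact iterMap_naturality G f n)
  map_id b := by
    ext n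
    change iterMap G (𝟙 b) n = 𝟙 _
    induction n with
    | zero => rfl
    | succ n ih =>
      change G.map _ = 𝟙 _
      rw [ih]
      exact G.map_id _
  map_comp f g := by
    ext n
    change iterMap G (f ≫ g) n = iterMap G f n ≫ iterMap G g n
    induction n with
    | zero => rfl
    | succ n ih =>
      change G.map _ = G.map _ ≫ G.map _
      rw [ih, ← G.map_comp]
      rfl

/-- The functor `b ↦ colim (1 ⟶ G(b, 1) ⟶ G(b, G(b, 1)) ⟶ ⋯)`. -/
noncomputable def fixF : B ⥤ Cpo := iterChain G ⋙ bilim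

/-- The cocone over the iterates with vertex `G(b, Fix G b)`. -/
noncomputable def unfoldCocone (b : B) : Limits.Cocone ((iterChain G).obj b) where
  pt := G.obj (b, (fixF G).obj b)
  ι := NatTrans.ofSequence (F := (iterChain G).obj b)
    (G := (Functor.const ℕ).obj (G.obj (b, (fixF G).obj b)))
    (fun n => match n with
      | 0 => fromOne _
      | n + 1 => G.map (Prod.mkHom (𝟙 b) (bilimIn ((iterChain G).obj b) n)))
    (fun n => match n with
      | 0 => fromOne_unique _ _
      | n + 1 => by
        have h := (bilimCocone ((iterChain G).obj b)).w (homOfLE (n.le_add_right 1))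
        have h1 := Functor.ofSequence_map_homOfLE_succ (iterStep G b) (n + 1)
        have h2 := Functor.ofSequence_map_homOfLE_succ (iterStep G b) n
        change (Functor.ofSequence (iterStep G b)).map _ ≫ bilimIn _ _ = bilimIn _ _ at h
        rw [h2] at h
        refine Eq.trans ?_ (Category.comp_id _).symm
        refine (congrArg (· ≫ G.map (Prod.mkHom (𝟙 b) (bilimIn ((iterChain G).obj b) (n + 1)))) h1).trans ?_
        change G.map (Prod.mkHom (𝟙 b) (iterStep G b n)) ≫
          G.map (Prod.mkHom (𝟙 b) (bilimIn ((iterChain G).obj b) (n + 1))) =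
          G.map (Prod.mkHom (𝟙 b) (bilimIn ((iterChain G).obj b) n))
        rw [← G.map_comp]
        congr 1
        refine Prod.ext ?_ ?_
        · simp
        · exact h)

/-- The canonical morphism `Fix G b ⟶ G(b, Fix G b)` given by the universal property of the
colimit `Fix G b`. It is an isomorphism when `G(b, -)` preserves colimits of ω-chains. -/
noncomputable def unfoldEP (b : B) : (fixF G).obj b ⟶ G.obj (b, (fixF G).obj b) :=
  (bilimIsColimit ((iterChain G).obj b)).desc (unfoldCocone G b)

variable {B' : Type u} [Category.{v} B'] (H : B' ⥤ B)

theorem iterStep_precomp (b : B') :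
    iterStep (H.prod (𝟭 Cpo) ⋙ G) b = iterStep G (H.obj b) := by
  funext n
  induction n with
  | zero => rfl
  | succ n ih =>
    change G.map (Prod.mkHom (H.map (𝟙 b)) (iterStep (H.prod (𝟭 Cpo) ⋙ G) b n)) =
      G.map (Prod.mkHom (𝟙 (H.obj b)) (iterStep G (H.obj b) n))
    rw [ih, H.map_id]
    rfl

theorem iterMap_precomp {b b' : B'} (f : b ⟶ b') (n : ℕ) :
    iterMap (H.prod (𝟭 Cpo) ⋙ G) f n = iterMap G (H.map f) n := by
  induction n with
  | zero => rfl
  | succ n ih =>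
    change G.map (Prod.mkHom (H.map f) (iterMap (H.prod (𝟭 Cpo) ⋙ G) f n)) =
      G.map (Prod.mkHom (H.map f) (iterMap G (H.map f) n))
    rw [ih]
    rfl

theorem eqToHom_ofSequence_app {X : ℕ → Cpo} {s s' : ∀ n, X n ⟶ X (n + 1)} (h : s = s')
    (e : Functor.ofSequence s = Functor.ofSequence s') (n : ℕ) :
    (eqToHom e).app n = 𝟙 (X n) := by
  subst h
  rfl

theorem iterChain_precomp : iterChain (H.prod (𝟭 Cpo) ⋙ G) = H ⋙ iterChain G := by
  refine CategoryTheory.Functor.ext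
    (fun b => congrArg (fun s => Functor.ofSequence (X := iterObj G (H.obj b)) s)
      (iterStep_precomp G H b)) ?_
  intro b b' f
  ext n
  have h1 := eqToHom_ofSequence_app (X := iterObj G (H.obj b)) (iterStep_precomp G H b)
    (congrArg _ (iterStep_precomp G H b)) n
  have h2 := eqToHom_ofSequence_app (X := iterObj G (H.obj b')) (iterStep_precomp G H b').symm
    (congrArg _ (iterStep_precomp G H b').symm) n
  rw [NatTrans.comp_app, NatTrans.comp_app]
  refine Eq.trans ?_ (congrArg₂ (fun u v => u ≫ iterMap G (H.map f) n ≫ v) h1 h2).symm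
  refine Eq.trans ?_ (Category.id_comp _).symm
  refine Eq.trans ?_ (Category.comp_id _).symm
  exact iterMap_precomp G H f n

theorem fixF_precomp : fixF (H.prod (𝟭 Cpo) ⋙ G) = H ⋙ fixF G := by
  unfold fixF
  rw [iterChain_precomp]
  rfl

end Fix

/-! ## Pure types -/

/-- Pure type expressions with type variables `0, …, n - 1` (de Bruijn indices); `mu τ` is the
recursive type `rec X. τ`, which binds the variable `0` of `τ`. A pure type is an element of
`Ty 0`. -/
inductive Ty : ℕ → Type
  | var {n : ℕ} (i : Fin n) : Ty n
  | unit {n : ℕ} : Ty n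
  | prod {n : ℕ} (σ τ : Ty n) : Ty n
  | arrow {n : ℕ} (σ τ : Ty n) : Ty n
  | sum {n : ℕ} (σ τ : Ty n) : Ty n
  | mu {n : ℕ} (τ : Ty (n + 1)) : Ty n

namespace Ty

/-- Extend a renaming under a binder. -/
def liftRen {n m : ℕ} (ρ : Fin n → Fin m) : Fin (n + 1) → Fin (m + 1) :=
  Fin.cases 0 (fun i => (ρ i).succ)

/-- Renaming of type variables. -/
def rename : {n m : ℕ} → (Fin n → Fin m) → Ty n → Ty m
  | _, _, ρ, var i => var (ρ i)
  | _, _, _, unit => unit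
  | _, _, ρ, prod σ τ => prod (rename ρ σ) (rename ρ τ)
  | _, _, ρ, arrow σ τ => arrow (rename ρ σ) (rename ρ τ)
  | _, _, ρ, sum σ τ => sum (rename ρ σ) (rename ρ τ)
  | _, _, ρ, mu τ => mu (rename (liftRen ρ) τ)

/-- Extend a substitution under a binder. -/
def liftSub {n m : ℕ} (s : Fin n → Ty m) : Fin (n + 1) → Ty (m + 1) :=
  Fin.cases (var 0) (fun i => rename Fin.succ (s i))

/-- Simultaneous capture-avoiding substitution. -/
def subst : {n m : ℕ} → (Fin n → Ty m) → Ty n → Ty m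
  | _, _, s, var i => s i
  | _, _, _, unit => unit
  | _, _, s, prod σ τ => prod (subst s σ) (subst s τ)
  | _, _, s, arrow σ τ => arrow (subst s σ) (subst s τ)
  | _, _, s, sum σ τ => sum (subst s σ) (subst s τ)
  | _, _, s, mu τ => mu (subst (liftSub s) τ)

/-- The substitution of `σ` for the variable `0`, which leaves the other variables alone. -/
def single {n : ℕ} (σ : Ty n) : Fin (n + 1) → Ty n := Fin.cases σ var

/-- The unfolding `τ[rec X. τ / X]` of the recursive type `rec X. τ`. -/
def unfolding {n : ℕ} (τ : Ty (n + 1)) : Ty n := subst (single (mu τ)) τ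

end Ty

/-! ## Interpretation of pure types -/

/-- Extend an environment by a value for the variable `0`. -/
def consF (n : ℕ) : (Fin n → Cpo) × Cpo ⥤ (Fin (n + 1) → Cpo) :=
  Functor.pi' (Fin.cases (CategoryTheory.Prod.snd _ _)
    (fun i => CategoryTheory.Prod.fst _ _ ⋙ Pi.eval _ i))

/-- The interpretation of a type expression with `n` free variables, as a functor on
embedding-projection pairs. -/
noncomputable def interp : {n : ℕ} → Ty n → ((Fin n → Cpo) ⥤ Cpo)
  | _, .var i => Pi.eval _ i
  | _, .unit => (Functor.const _).obj two
  | _, .prod σ τ => (interp σ).prod' (interp τ) ⋙ prodF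
  | _, .arrow σ τ => (interp σ).prod' (interp τ) ⋙ arrowF
  | _, .sum σ τ => (interp σ).prod' (interp τ) ⋙ sumF
  | n, .mu τ => fixF (consF n ⋙ interp τ)

/-- The functor on environments induced by a renaming. -/
def renF {n m : ℕ} (ρ : Fin n → Fin m) : (Fin m → Cpo) ⥤ (Fin n → Cpo) :=
  Functor.pi' (fun i => Pi.eval _ (ρ i))

/-- The functor on environments induced by a substitution. -/
noncomputable def subF {n m : ℕ} (s : Fin n → Ty m) : (Fin m → Cpo) ⥤ (Fin n → Cpo) :=
  Functor.pi' (fun i => interp (s i))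

theorem cons_renF {n m : ℕ} (ρ : Fin n → Fin m) :
    consF m ⋙ renF (Ty.liftRen ρ) = (renF ρ).prod (𝟭 Cpo) ⋙ consF n :=
  Functor.pi_ext _ _ fun i => by refine Fin.cases ?_ (fun i => ?_) i <;> rfl

theorem interp_rename {n : ℕ} (τ : Ty n) : ∀ {m : ℕ} (ρ : Fin n → Fin m),
    interp (τ.rename ρ) = renF ρ ⋙ interp τ := by
  induction τ with
  | var i => intro m ρ; rfl
  | unit => intro m ρ; rfl
  | prod σ τ h1 h2 => intro m ρ; simp only [Ty.rename, interp, h1 ρ, h2 ρ]; rfl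
  | arrow σ τ h1 h2 => intro m ρ; simp only [Ty.rename, interp, h1 ρ, h2 ρ]; rfl
  | sum σ τ h1 h2 => intro m ρ; simp only [Ty.rename, interp, h1 ρ, h2 ρ]; rfl
  | mu τ h =>
    intro m ρ
    simp only [Ty.rename, interp, h (Ty.liftRen ρ)]
    rw [← Functor.assoc, cons_renF, Functor.assoc]
    exact fixF_precomp _ _

theorem cons_subF {n m : ℕ} (s : Fin n → Ty m) :
    consF m ⋙ subF (Ty.liftSub s) = (subF s).prod (𝟭 Cpo) ⋙ consF n :=
  Functor.pi_ext _ _ fun i => by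
    refine Fin.cases ?_ (fun i => ?_) i
    · rfl
    · change consF m ⋙ interp (Ty.rename Fin.succ (s i)) = _
      rw [interp_rename]
      rfl

/-- Substitution is interpreted by composition. -/
theorem interp_subst {n : ℕ} (τ : Ty n) : ∀ {m : ℕ} (s : Fin n → Ty m),
    interp (τ.subst s) = subF s ⋙ interp τ := by
  induction τ with
  | var i => intro m s; rfl
  | unit => intro m s; rfl
  | prod σ τ h1 h2 => intro m s; simp only [Ty.subst, interp, h1 s, h2 s]; rfl
  | arrow σ τ h1 h2 => intro m s; simp only [Ty.subst, interp, h1 s, h2 s]; rfl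
  | sum σ τ h1 h2 => intro m s; simp only [Ty.subst, interp, h1 s, h2 s]; rfl
  | mu τ h =>
    intro m s
    simp only [Ty.subst, interp, h (Ty.liftSub s)]
    rw [← Functor.assoc, cons_subF, Functor.assoc]
    exact fixF_precomp _ _

theorem interp_unfolding {n : ℕ} (τ : Ty (n + 1)) (X : Fin n → Cpo) :
    (consF n ⋙ interp τ).obj (X, (interp τ.mu).obj X) = (interp τ.unfolding).obj X := by
  unfold Ty.unfolding
  rw [interp_subst]
  change (interp τ).obj _ = (interp τ).obj _
  congr 1
  funext i
  refine Fin.cases ?_ (fun i => ?_) i <;> rfl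

/-- The interpretation of a pure type. -/
noncomputable def sem (τ : Ty 0) : Cpo := (interp τ).obj (fun i => i.elim0)

/-- The embedding part of the canonical morphism from `rec X. τ` to its unfolding (which is an
isomorphism, since the functors `interp τ` preserve colimits of ω-chains). The `eqToHom` only
identifies `τ[rec X. τ / X]` with the value of `τ` at `rec X. τ`. -/
noncomputable def unfold (τ : Ty 1) : ScottMap (sem τ.mu) (sem τ.unfolding) :=
  EP.emb (unfoldEP (consF 0 ⋙ interp τ) (fun i => i.elim0) ≫ eqToHom (interp_unfolding τ _))

/-! ## The logic -/

/-- The formulae of the fragment without disjunctions, fixpoints and iteration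
(but with falsity), indexed by their pure type. -/
inductive Form : Ty 0 → Type
  | top {τ : Ty 0} : Form τ
  | bot {τ : Ty 0} : Form τ
  | and {τ : Ty 0} (φ ψ : Form τ) : Form τ
  | unit : Form .unit
  | fst {σ τ : Ty 0} (φ : Form σ) : Form (.prod σ τ)
  | snd {σ τ : Ty 0} (φ : Form τ) : Form (.prod σ τ)
  | fold {τ : Ty 1} (φ : Form τ.unfolding) : Form (.mu τ)
  | inl {σ τ : Ty 0} (φ : Form σ) : Form (.sum σ τ)
  | inr {σ τ : Ty 0} (φ : Form τ) : Form (.sum σ τ)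
  | imp {σ τ : Ty 0} (ψ : Form σ) (φ : Form τ) : Form (.arrow σ τ)

/-- The interpretation of formulae. -/
noncomputable def Form.sem : {τ : Ty 0} → Form τ → Set (DomainLogic.sem τ)
  | _, .top => Set.univ
  | _, .bot => ∅
  | _, .and φ ψ => φ.sem ∩ ψ.sem
  | _, .unit => {(True : Prop)}
  | _, .fst (σ := σ) (τ := τ) φ =>
      {x : prodObj (DomainLogic.sem σ) (DomainLogic.sem τ) | x.1 ∈ φ.sem}
  | _, .snd (σ := σ) (τ := τ) φ =>
      {x : prodObj (DomainLogic.sem σ) (DomainLogic.sem τ) | x.2 ∈ φ.sem}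
  | _, .fold (τ := τ) φ => {x : DomainLogic.sem τ.mu | unfold τ x ∈ φ.sem}
  | _, .inl (σ := σ) (τ := τ) φ =>
      (sumInl : DomainLogic.sem σ → sumObj (DomainLogic.sem σ) (DomainLogic.sem τ)) '' φ.sem
  | _, .inr (σ := σ) (τ := τ) φ =>
      (sumInr : DomainLogic.sem τ → sumObj (DomainLogic.sem σ) (DomainLogic.sem τ)) '' φ.sem
  | _, .imp (σ := σ) (τ := τ) ψ φ =>
      {f : ScottMap (DomainLogic.sem σ) (DomainLogic.sem τ) | ∀ x ∈ ψ.sem, f x ∈ φ.sem}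

end DomainLogic

namespace DomainLogic

/-! ## Compact elements -/

/-! Every type expression maps Scott domains (bounded complete algebraic cpos) to Scott domains
(`isScottDomain_interp`), so two compact elements with a common upper bound have a compact join.

Part (1) is an induction on the formula, driven by one principle (`isCompactElement_of_adjoint`): if
a Scott-continuous `g` has a left adjoint `f`, then the preimage of `↑d` under `g` is `↑(f d)`, and
`f d` is compact whenever `d` is. This covers the two projections, evaluation at a compact point
(whose left adjoint is a step function, `step_le`) and `unfold`. A conjunction denotes the filter of
a join, and an injection into a sum is an order embedding onto an upper set. For `unfold` the
canonical embedding-projection pair must be shown to be an isomorphism; this follows from local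
continuity of type expressions (`exhausts_interp`), as the finite stages of the recursive type
exhaust its unfolding.

Part (2) cannot be an induction on closed types, because unfolding a recursive type does not make it
smaller. The statement is generalised to open expressions (`definable_map`): the variables are
assigned Scott domains `X i` that embed into the meanings of closed types `s i`, with the images of
compact elements definable, and the same is then proved for the whole expression. At a recursive
type, a compact element of the colimit already lives at a finite stage. An inner induction on the
stage uses the hypothesis for the body, with the bound variable assigned the previous stage, and
closes with the `fold` modality. At a function type, compact elements are finite joins of compact
step functions, and embeddings preserve joins. -/

theorem isCompactElement_bot (X : Cpo) : IsCompactElement (⊥ : X) :=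
  fun _ _ hne _ _ _ => hne.imp fun _ hx => ⟨hx, bot_le⟩

/-- A map with a Scott-continuous right adjoint preserves compact elements. -/
theorem isCompactElement_of_adjoint {X Y : Cpo} {f : X → Y} (g : ScottMap Y X)
    (hfg : ∀ x y, f x ≤ y ↔ x ≤ g y) {x : X} (hx : IsCompactElement x) :
    IsCompactElement (f x) := by
  intro D u hne hD hu h
  obtain ⟨_, ⟨y, hy, rfl⟩, hxy⟩ := hx (g '' D) (g u) (hne.image _)
    (ScottMap.directed_image g.mono hD) (g.cont hne hD hu) ((hfg _ _).1 h)
  exact ⟨y, hy, (hfg _ _).2 hxy⟩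

/-- A Scott-continuous order embedding reflects compact elements. -/
theorem isCompactElement_of_map {X Y : Cpo} (f : ScottMap X Y)
    (hf : ∀ x y, f x ≤ f y → x ≤ y) {x : X} (hx : IsCompactElement (f x)) :
    IsCompactElement x := by
  intro D u hne hD hu h
  obtain ⟨_, ⟨y, hy, rfl⟩, hxy⟩ := hx (f '' D) (f u) (hne.image _)
    (ScottMap.directed_image f.mono hD) (f.cont hne hD hu) (f.mono h)
  exact ⟨y, hy, hf _ _ hxy⟩

theorem isCompactElement_of_isLUB {X : Cpo} {x y z : X} (hx : IsCompactElement x)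
    (hy : IsCompactElement y) (hz : IsLUB {x, y} z) : IsCompactElement z := by
  intro D u hne hD hu h
  obtain ⟨a, ha, hxa⟩ := hx D u hne hD hu ((hz.1 (by simp)).trans h)
  obtain ⟨b, hb, hyb⟩ := hy D u hne hD hu ((hz.1 (by simp)).trans h)
  obtain ⟨c, hc, hac, hbc⟩ := hD a ha b hb
  refine ⟨c, hc, hz.2 ?_⟩
  rintro _ (rfl | rfl)
  · exact hxa.trans hac
  · exact hyb.trans hbc

theorem isLUB_pair_iff {X : Type} [PartialOrder X] {x y z : X} :
    IsLUB {x, y} z ↔ ∀ u, z ≤ u ↔ x ≤ u ∧ y ≤ u := by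
  simp [isLUB_iff_le_iff, upperBounds_insert]

namespace EP

variable {X Y : Cpo} (f : X ⟶ Y)

theorem emb_le_iff (x : X) (y : Y) : EP.emb f x ≤ y ↔ x ≤ EP.proj f y :=
  ⟨fun h => by simpa [f.proj_emb] using (EP.proj f).mono h,
    fun h => ((EP.emb f).mono h).trans (f.emb_proj y)⟩

theorem emb_le_emb (x y : X) : EP.emb f x ≤ EP.emb f y ↔ x ≤ y := by
  rw [emb_le_iff, f.proj_emb]

theorem emb_bot : EP.emb f ⊥ = ⊥ := le_bot_iff.1 ((emb_le_iff f _ _).2 bot_le)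

theorem isCompactElement_emb {x : X} (hx : IsCompactElement x) : IsCompactElement (EP.emb f x) :=
  isCompactElement_of_adjoint (EP.proj f) (emb_le_iff f) hx

theorem isLUB_emb {x y z : X} (h : IsLUB {x, y} z) :
    IsLUB {EP.emb f x, EP.emb f y} (EP.emb f z) := by
  rw [isLUB_pair_iff] at h ⊢
  intro u
  simp only [emb_le_iff, h]

end EP

/-! ## Scott domains -/

/-- Bounded complete algebraic cpos. Countability of the basis is not required. -/
structure IsScottDomain (X : Cpo) : Prop where
  exists_isLUB : ∀ x y u : X, x ≤ u → y ≤ u → ∃ z, IsLUB {x, y} z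
  le_of_compact : ∀ x u : X, (∀ c, IsCompactElement c → c ≤ x → c ≤ u) → x ≤ u

namespace IsScottDomain

theorem compacts_directed {X : Cpo} (hX : IsScottDomain X) (x : X) :
    DirectedOn (· ≤ ·) {c : X | IsCompactElement c ∧ c ≤ x} := by
  rintro a ⟨ha, hax⟩ b ⟨hb, hbx⟩
  obtain ⟨z, hz⟩ := hX.exists_isLUB a b x hax hbx
  refine ⟨z, ⟨isCompactElement_of_isLUB ha hb hz, ?_⟩, hz.1 (by simp), hz.1 (by simp)⟩
  exact (isLUB_pair_iff.1 hz x).2 ⟨hax, hbx⟩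

theorem compacts_isLUB {X : Cpo} (hX : IsScottDomain X) (x : X) :
    IsLUB {c : X | IsCompactElement c ∧ c ≤ x} x :=
  ⟨fun _ hc => hc.2, fun u hu => hX.le_of_compact x u fun _ h1 h2 => hu ⟨h1, h2⟩⟩

theorem map_le {X Y : Cpo} (hX : IsScottDomain X) (f : ScottMap X Y) {x : X} {u : Y}
    (h : ∀ c, IsCompactElement c → c ≤ x → f c ≤ u) : f x ≤ u :=
  f.map_le (D := {c | IsCompactElement c ∧ c ≤ x}) ⟨⊥, isCompactElement_bot X, bot_le⟩ (hX.compacts_directed x) (hX.compacts_isLUB x)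
    fun c hc => h c hc.1 hc.2

/-- A property of compact elements holds if it holds for `⊥` and a basis and is stable under
binary suprema. -/
theorem compact_induction {X : Cpo} (hX : IsScottDomain X) {S : Set X}
    (hS : ∀ x u : X, (∀ c ∈ S, c ≤ x → c ≤ u) → x ≤ u) {P : X → Prop} (bot : P ⊥)
    (basis : ∀ c ∈ S, P c) (lub : ∀ x y z, P x → P y → IsLUB {x, y} z → P z)
    {d : X} (hd : IsCompactElement d) : P d := by
  -- Closure under joins makes this set directed, and the basis makes `d` its supremum. Compactness
  -- then puts `d` itself in the set.
  obtain ⟨x, ⟨hx, hxd⟩, hdx⟩ := hd {x | P x ∧ x ≤ d} d ⟨⊥, bot, bot_le⟩ (by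
    rintro a ⟨ha, had⟩ b ⟨hb, hbd⟩
    obtain ⟨z, hz⟩ := hX.exists_isLUB a b d had hbd
    exact ⟨z, ⟨lub a b z ha hb hz, (isLUB_pair_iff.1 hz d).2 ⟨had, hbd⟩⟩,
      hz.1 (by simp), hz.1 (by simp)⟩)
    ⟨fun x hx => hx.2, fun u hu => hS d u fun c hc hcd => hu ⟨basis c hc, hcd⟩⟩ le_rfl
  exact le_antisymm hxd hdx ▸ hx

end IsScottDomain

theorem isScottDomain_one : IsScottDomain one where
  exists_isLUB x _ _ _ _ := ⟨x, isLUB_pair_iff.2 fun _ =>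
    ⟨fun _ => ⟨(Subsingleton.elim _ _).le, (Subsingleton.elim _ _).le⟩,
      fun _ => (Subsingleton.elim _ _).le⟩⟩
  le_of_compact _ _ _ := (Subsingleton.elim _ _).le

theorem isCompactElement_two_true : IsCompactElement (show two from (True : Prop)) := by
  intro D u _ _ hu h
  by_contra hno
  push Not at hno
  have : u ≤ (show two from False) := hu.2 fun p hp (h' : p) => hno p hp fun _ => h'
  exact this (h trivial)

theorem isScottDomain_two : IsScottDomain two where
  exists_isLUB (x y : Prop) _ _ _ := ⟨(x ∨ y : Prop), isLUB_pair_iff.2 fun (u : Prop) =>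
    (or_imp : (x ∨ y → u) ↔ _)⟩
  le_of_compact _ _ h := fun hx =>
    h (show two from (True : Prop)) isCompactElement_two_true (fun _ => hx) trivial

/-! ### Products -/

theorem prodObj_le {X Y : Cpo} {p q : prodObj X Y} : p ≤ q ↔ p.1 ≤ q.1 ∧ p.2 ≤ q.2 := Iff.rfl

/-- The pair of two elements, as an element of the product cpo. -/
def pair {X Y : Cpo} (x : X) (y : Y) : prodObj X Y := (x, y)

theorem pair_le {X Y : Cpo} {x : X} {y : Y} {q : prodObj X Y} :
    pair x y ≤ q ↔ x ≤ q.1 ∧ y ≤ q.2 := Iff.rfl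

/-- The first projection, as a Scott-continuous function. -/
def fstMap (X Y : Cpo) : ScottMap (prodObj X Y) X := ⟨Prod.fst, ScottContinuous.fst⟩

/-- The second projection, as a Scott-continuous function. -/
def sndMap (X Y : Cpo) : ScottMap (prodObj X Y) Y := ⟨Prod.snd, ScottContinuous.snd⟩

/-- Pairing with `⊥` is left adjoint to the projection. This gives both the compactness of `pair x
⊥` and the filter denoted by `Form.fst`. -/
theorem pair_bot_le {X Y : Cpo} (x : X) (q : prodObj X Y) :
    pair x ⊥ ≤ q ↔ x ≤ fstMap X Y q := pair_le.trans (and_iff_left bot_le)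

theorem bot_pair_le {X Y : Cpo} (y : Y) (q : prodObj X Y) :
    pair ⊥ y ≤ q ↔ y ≤ sndMap X Y q := pair_le.trans (and_iff_right bot_le)

theorem isCompactElement_pair_bot {X Y : Cpo} {x : X} (hx : IsCompactElement x) :
    IsCompactElement (pair x (⊥ : Y)) :=
  isCompactElement_of_adjoint (fstMap X Y) pair_bot_le hx

theorem isCompactElement_bot_pair {X Y : Cpo} {y : Y} (hy : IsCompactElement y) :
    IsCompactElement (pair (⊥ : X) y) :=
  isCompactElement_of_adjoint (sndMap X Y) bot_pair_le hy

theorem isScottDomain_prod {X Y : Cpo} (hX : IsScottDomain X) (hY : IsScottDomain Y) :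
    IsScottDomain (prodObj X Y) where
  exists_isLUB p q u hp hq := by
    obtain ⟨a, ha⟩ := hX.exists_isLUB _ _ _ hp.1 hq.1
    obtain ⟨b, hb⟩ := hY.exists_isLUB _ _ _ hp.2 hq.2
    rw [isLUB_pair_iff] at ha hb
    exact ⟨pair a b, isLUB_pair_iff.2 fun v => by
      rw [pair_le, ha, hb, prodObj_le, prodObj_le, and_and_and_comm]⟩
  le_of_compact p u h := ⟨hX.le_of_compact _ _ fun c hc hcp =>
      (pair_bot_le _ _).1 (h _ (isCompactElement_pair_bot hc) ((pair_bot_le _ _).2 hcp)),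
    hY.le_of_compact _ _ fun c hc hcp =>
      (bot_pair_le _ _).1 (h _ (isCompactElement_bot_pair hc) ((bot_pair_le _ _).2 hcp))⟩

/-! ### Sums -/

/-- Order embeddings onto an upper set above an added least element. -/
structure IsSummand {X Z : Cpo} (j : X → Z) : Prop where
  le_iff : ∀ x y, j x ≤ j y ↔ x ≤ y
  upper : ∀ x z, j x ≤ z → ∃ y, z = j y
  lower : ∀ x z, z ≤ j x → z = ⊥ ∨ ∃ y, z = j y
  ne_bot : ∀ x, j x ≠ ⊥

theorem sumObj_cases {X Y : Cpo} (z : sumObj X Y) :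
    z = ⊥ ∨ (∃ x, z = sumInl x) ∨ ∃ y, z = sumInr y := by
  change WithBot (X ⊕ Y) at z
  induction z using WithBot.recBotCoe with
  | bot => exact Or.inl rfl
  | coe z =>
    rcases z with x | y
    · exact Or.inr (Or.inl ⟨x, rfl⟩)
    · exact Or.inr (Or.inr ⟨y, rfl⟩)

theorem sumInl_le_sumInl {X Y : Cpo} (x x' : X) :
    (sumInl x : sumObj X Y) ≤ sumInl x' ↔ x ≤ x' :=
  WithBot.coe_le_coe.trans Sum.inl_le_inl_iff

theorem sumInr_le_sumInr {X Y : Cpo} (y y' : Y) :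
    (sumInr y : sumObj X Y) ≤ sumInr y' ↔ y ≤ y' :=
  WithBot.coe_le_coe.trans Sum.inr_le_inr_iff

theorem not_sumInl_le_sumInr {X Y : Cpo} (x : X) (y : Y) :
    ¬ (sumInl x : sumObj X Y) ≤ sumInr y :=
  fun h => Sum.not_inl_le_inr (WithBot.coe_le_coe.1 h)

theorem not_sumInr_le_sumInl {X Y : Cpo} (x : X) (y : Y) :
    ¬ (sumInr y : sumObj X Y) ≤ sumInl x :=
  fun h => Sum.not_inr_le_inl (WithBot.coe_le_coe.1 h)

theorem isSummand_sumInl (X Y : Cpo) : IsSummand (sumInl : X → sumObj X Y) where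
  le_iff := sumInl_le_sumInl
  ne_bot _ := WithBot.coe_ne_bot
  upper x z h := by
    rcases sumObj_cases z with rfl | hz | ⟨y, rfl⟩
    · exact absurd (le_bot_iff.1 h) WithBot.coe_ne_bot
    · exact hz
    · exact absurd h (not_sumInl_le_sumInr x y)
  lower x z h := by
    rcases sumObj_cases z with hz | hz | ⟨y, rfl⟩
    · exact Or.inl hz
    · exact Or.inr hz
    · exact absurd h (not_sumInr_le_sumInl x y)

theorem isSummand_sumInr (X Y : Cpo) : IsSummand (sumInr : Y → sumObj X Y) where
  le_iff := sumInr_le_sumInr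
  ne_bot _ := WithBot.coe_ne_bot
  upper y z h := by
    rcases sumObj_cases z with rfl | ⟨x, rfl⟩ | hz
    · exact absurd (le_bot_iff.1 h) WithBot.coe_ne_bot
    · exact absurd h (not_sumInr_le_sumInl x y)
    · exact hz
  lower y z h := by
    rcases sumObj_cases z with hz | ⟨x, rfl⟩ | hz
    · exact Or.inl hz
    · exact absurd h (not_sumInl_le_sumInr x y)
    · exact Or.inr hz

namespace IsSummand

variable {X Z : Cpo} {j : X → Z}

theorem image_Ici (hj : IsSummand j) (d : X) : j '' Set.Ici d = Set.Ici (j d) := by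
  ext z
  constructor
  · rintro ⟨x, hx, rfl⟩
    exact (hj.le_iff _ _).2 hx
  · intro hz
    obtain ⟨x, rfl⟩ := hj.upper d z hz
    exact ⟨x, (hj.le_iff _ _).1 hz, rfl⟩

/-- A directed set whose supremum lies in the summand consists of `⊥` and points of the summand. Not
all members are `⊥`, so the set can be pulled back along `j`. -/
theorem isCompactElement (hj : IsSummand j) {x : X} (hx : IsCompactElement x) : IsCompactElement (j x) := by
  intro D u hne hD hu hxu
  obtain ⟨s, rfl⟩ := hj.upper x u hxu
  have hex : ∃ y, j y ∈ D := by
    by_contra hno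
    refine hj.ne_bot s (le_bot_iff.1 (hu.2 fun z hz => ?_))
    rcases hj.lower s z (hu.1 hz) with rfl | ⟨y, rfl⟩
    · exact le_rfl
    · exact absurd ⟨y, hz⟩ hno
  obtain ⟨y₀, hy₀⟩ := hex
  obtain ⟨y, hy, hxy⟩ := hx {y | j y ∈ D} s ⟨y₀, hy₀⟩ (by
      intro a ha b hb
      obtain ⟨z, hz, haz, hbz⟩ := hD _ ha _ hb
      obtain ⟨c, rfl⟩ := hj.upper a z haz
      exact ⟨c, hz, (hj.le_iff _ _).1 haz, (hj.le_iff _ _).1 hbz⟩)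
    ⟨fun y hy => (hj.le_iff _ _).1 (hu.1 hy), fun v hv => (hj.le_iff _ _).1 (hu.2 fun z hz => by
      rcases hj.lower s z (hu.1 hz) with rfl | ⟨y, rfl⟩
      · exact bot_le
      · exact (hj.le_iff _ _).2 (hv hz))⟩
    ((hj.le_iff _ _).1 hxu)
  exact ⟨j y, hy, (hj.le_iff _ _).2 hxy⟩

/-- The map `j` preserves suprema of nonempty sets, since any upper bound of a nonempty part of the
summand is again in the summand. -/
theorem of_isCompactElement (hj : IsSummand j) {x : X} (hx : IsCompactElement (j x)) : IsCompactElement x := by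
  intro D u hne hD hu hxu
  obtain ⟨_, ⟨y, hy, rfl⟩, hxy⟩ := hx (j '' D) (j u) (hne.image _)
    (ScottMap.directed_image (fun _ _ h => (hj.le_iff _ _).2 h) hD)
    ⟨by
      rintro _ ⟨y, hy, rfl⟩
      exact (hj.le_iff _ _).2 (hu.1 hy), fun v hv => by
      obtain ⟨y, hy⟩ := hne
      obtain ⟨w, rfl⟩ := hj.upper y v (hv ⟨y, hy, rfl⟩)
      exact (hj.le_iff _ _).2 (hu.2 fun z hz => (hj.le_iff _ _).1 (hv ⟨z, hz, rfl⟩))⟩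
    ((hj.le_iff _ _).2 hxu)
  exact ⟨y, hy, (hj.le_iff _ _).1 hxy⟩

theorem exists_isLUB (hj : IsSummand j) (hX : IsScottDomain X) (x : X) (z u : Z) (hx : j x ≤ u) (hz : z ≤ u) :
    ∃ w, IsLUB {j x, z} w := by
  obtain ⟨u, rfl⟩ := hj.upper x u hx
  rcases hj.lower u z hz with rfl | ⟨y, rfl⟩
  · exact ⟨j x, isLUB_pair_iff.2 fun _ => (and_iff_left bot_le).symm⟩
  · obtain ⟨w, hw⟩ := hX.exists_isLUB x y u ((hj.le_iff _ _).1 hx) ((hj.le_iff _ _).1 hz)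
    rw [isLUB_pair_iff] at hw
    refine ⟨j w, isLUB_pair_iff.2 fun v => ⟨fun h => ?_, fun h => ?_⟩⟩
    · have h' := (hw w).1 le_rfl
      exact ⟨((hj.le_iff _ _).2 h'.1).trans h, ((hj.le_iff _ _).2 h'.2).trans h⟩
    · obtain ⟨v, rfl⟩ := hj.upper x v h.1
      rw [hj.le_iff, hj.le_iff] at h
      exact (hj.le_iff _ _).2 ((hw v).2 h)

theorem le_of_compact (hj : IsSummand j) (hX : IsScottDomain X) (x : X) (u : Z)
    (h : ∀ c, IsCompactElement c → c ≤ j x → c ≤ u) : j x ≤ u := by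
  -- Testing the hypothesis on the compact element `j ⊥` already forces `u` into the summand.
  obtain ⟨u, rfl⟩ := hj.upper _ _
    (h (j ⊥) (hj.isCompactElement (isCompactElement_bot X)) ((hj.le_iff _ _).2 bot_le))
  exact (hj.le_iff _ _).2 (hX.le_of_compact _ _ fun c hc hcx =>
    (hj.le_iff _ _).1 (h _ (hj.isCompactElement hc) ((hj.le_iff _ _).2 hcx)))

end IsSummand

theorem isScottDomain_sum {X Y : Cpo} (hX : IsScottDomain X) (hY : IsScottDomain Y) :
    IsScottDomain (sumObj X Y) where
  exists_isLUB p q u hp hq := by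
    rcases sumObj_cases p with rfl | ⟨x, rfl⟩ | ⟨y, rfl⟩
    · exact ⟨q, isLUB_pair_iff.2 fun _ => (and_iff_right bot_le).symm⟩
    · exact (isSummand_sumInl X Y).exists_isLUB hX x q u hp hq
    · exact (isSummand_sumInr X Y).exists_isLUB hY y q u hp hq
  le_of_compact p u h := by
    rcases sumObj_cases p with rfl | ⟨x, rfl⟩ | ⟨y, rfl⟩
    · exact bot_le
    · exact (isSummand_sumInl X Y).le_of_compact hX x u h
    · exact (isSummand_sumInr X Y).le_of_compact hY y u h

/-! ### Function spaces -/

open Classical in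
/-- The step function with value `b` above the compact element `a`, and `⊥` elsewhere. -/
noncomputable def step {X Y : Cpo} {a : X} (ha : IsCompactElement a) (b : Y) : arrowObj X Y where
  toFun x := if a ≤ x then b else ⊥
  cont := ScottMap.scott_of
    (fun x y hxy => by
      by_cases h : a ≤ x
      · simp [h, h.trans hxy]
      · simp [h])
    (fun D s hne hD hs u hu => by
      by_cases h : a ≤ s
      · obtain ⟨x, hx, hax⟩ := ha D s hne hD hs h
        simpa [h, hax] using hu x hx
      · simp [h])

/-- Application, for elements of the function space. -/
def app {X Y : Cpo} (f : arrowObj X Y) (x : X) : Y := ScottMap.toFun f x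

theorem arrow_le {X Y : Cpo} {f g : arrowObj X Y} : f ≤ g ↔ ∀ x, app f x ≤ app g x := Iff.rfl

theorem app_mono {X Y : Cpo} (f : arrowObj X Y) : Monotone (app f) := ScottMap.mono f

theorem app_step_of_le {X Y : Cpo} {a x : X} (ha : IsCompactElement a) (b : Y) (h : a ≤ x) :
    app (step ha b) x = b := if_pos h

theorem app_step_of_not_le {X Y : Cpo} {a x : X} (ha : IsCompactElement a) (b : Y) (h : ¬ a ≤ x) :
    app (step ha b) x = ⊥ := if_neg h

/-- This adjunction between `step ha` and evaluation at `a` is used for everything about step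
functions: compactness, behaviour under embeddings, and the meaning of implication. -/
theorem step_le {X Y : Cpo} {a : X} (ha : IsCompactElement a) (b : Y) (f : arrowObj X Y) :
    step ha b ≤ f ↔ b ≤ app f a := by
  refine ⟨fun h => (app_step_of_le ha b le_rfl).symm.le.trans (arrow_le.1 h a),
    fun h => arrow_le.2 fun x => ?_⟩
  by_cases hx : a ≤ x
  · rw [app_step_of_le ha b hx]
    exact h.trans (app_mono f hx)
  · rw [app_step_of_not_le ha b hx]
    exact bot_le

/-- Evaluation at a point, as a Scott-continuous function. -/
def evalMap {X : Cpo} (Y : Cpo) (a : X) : ScottMap (arrowObj X Y) Y where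
  toFun f := app f a
  cont := ScottMap.scott_of (fun _ _ h => h a) fun _ _ _ hD hs _ hu =>
    (ScottMap.isLUB_apply hD hs a).2 (by rintro _ ⟨f, hf, rfl⟩; exact hu f hf)

theorem isCompactElement_step {X Y : Cpo} {a : X} (ha : IsCompactElement a) {b : Y}
    (hb : IsCompactElement b) : IsCompactElement (step ha b) :=
  isCompactElement_of_adjoint (f := step ha) (evalMap Y a) (step_le ha) hb

/-- The compact step functions of a function space. -/
def stepSet (X Y : Cpo) : Set (arrowObj X Y) :=
  {f | ∃ (a : X) (ha : IsCompactElement a) (b : Y), IsCompactElement b ∧ f = step ha b}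

/-- By continuity `f x` is the supremum of `f a` over compact `a ≤ x`, and each `f a` is the
supremum of the compact `b` below it; such pairs are exactly the steps below `f`. -/
theorem le_of_step {X Y : Cpo} (hX : IsScottDomain X) (hY : IsScottDomain Y)
    (f u : arrowObj X Y) (h : ∀ c ∈ stepSet X Y, c ≤ f → c ≤ u) : f ≤ u :=
  arrow_le.2 fun _ => hX.map_le (f : ScottMap X Y) fun a ha hax =>
    (hY.le_of_compact _ _ fun b hb hbf =>
      (step_le ha b u).1 (h _ ⟨a, ha, b, hb, rfl⟩ ((step_le ha b f).2 hbf))).trans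
        (app_mono u hax)

theorem isScottDomain_arrow {X Y : Cpo} (hX : IsScottDomain X) (hY : IsScottDomain Y) :
    IsScottDomain (arrowObj X Y) where
  exists_isLUB f g u hf hg := by
    -- The join is computed pointwise: `u x` bounds both values, and the universal property of each
    -- pointwise join yields monotonicity and continuity in `x`.
    have hex : ∀ x, ∃ z, ∀ v, z ≤ v ↔ app f x ≤ v ∧ app g x ≤ v := fun x =>
      (hY.exists_isLUB _ _ _ (hf x) (hg x)).imp fun _ => isLUB_pair_iff.1
    choose z hz using hex
    have hle : ∀ x, app f x ≤ z x ∧ app g x ≤ z x := fun x => (hz x _).1 le_rfl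
    refine ⟨(⟨z, ScottMap.scott_of (fun x y hxy => (hz x _).2
      ⟨(app_mono f hxy).trans (hle y).1, (app_mono g hxy).trans (hle y).2⟩) ?_⟩ : ScottMap X Y), ?_⟩
    · intro D s hne hD hs v hv
      exact (hz s v).2
        ⟨ScottMap.map_le f hne hD hs fun x hx => (hle x).1.trans (hv x hx),
          ScottMap.map_le g hne hD hs fun x hx => (hle x).2.trans (hv x hx)⟩
    · exact isLUB_pair_iff.2 fun v => ⟨fun h => ⟨fun x => (hle x).1.trans (h x),
        fun x => (hle x).2.trans (h x)⟩, fun h x => (hz x _).2 ⟨h.1 x, h.2 x⟩⟩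
  le_of_compact f u h := le_of_step hX hY f u fun c hc hcf => h c (by
    obtain ⟨a, ha, b, hb, rfl⟩ := hc
    exact isCompactElement_step ha hb) hcf

/-! ### Bilimits -/

section Bilimit

variable {F : ℕ ⥤ Cpo}

theorem bilimIn_emb_proj_mono (x : bilimObj F) :
    Monotone fun n => (bilimIn F n).emb ((bilimIn F n).proj x) :=
  cocone_emb_mono (bilimCocone F) x

theorem bilimIn_le (x u : bilimObj F)
    (h : ∀ n, (bilimIn F n).emb ((bilimIn F n).proj x) ≤ u) : x ≤ u := fun n => by
  have := (bilimIn F n).proj.mono (h n)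
  rwa [EP.proj_emb] at this

theorem bilimIn_isLUB (x : bilimObj F) :
    IsLUB (Set.range fun n => (bilimIn F n).emb ((bilimIn F n).proj x)) x :=
  ⟨by rintro _ ⟨n, rfl⟩; exact (bilimIn F n).emb_proj x,
    fun u hu => bilimIn_le x u fun n => hu ⟨n, rfl⟩⟩

/-- Every compact element of a bilimit comes from a compact element of the chain. -/
theorem exists_compact_of_bilim {d : bilimObj F} (hd : IsCompactElement d) :
    ∃ n, ∃ x : F.obj n, IsCompactElement x ∧ (bilimIn F n).emb x = d := by
  -- A compact element equals one of the truncations that increase to it.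
  obtain ⟨_, ⟨n, rfl⟩, h⟩ := hd _ d (Set.range_nonempty _)
    (bilimIn_emb_proj_mono d).directed_le.directedOn_range (bilimIn_isLUB d) le_rfl
  have h' := le_antisymm ((bilimIn F n).emb_proj d) h
  exact ⟨n, _, isCompactElement_of_map (bilimIn F n).emb
    (fun x y => (EP.emb_le_emb (bilimIn F n) x y).1) (h'.symm ▸ hd), h'⟩

theorem isScottDomain_bilim (hF : ∀ n, IsScottDomain (F.obj n)) : IsScottDomain (bilimObj F) where
  exists_isLUB x y u hx hy := by
    choose z hz using fun n => (hF n).exists_isLUB ((bilimIn F n).proj x) ((bilimIn F n).proj y)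
      ((bilimIn F n).proj u) ((bilimIn F n).proj.mono hx) ((bilimIn F n).proj.mono hy)
    have hz' := fun n => isLUB_pair_iff.1 (EP.isLUB_emb (bilimIn F n) (hz n))
    -- The joins taken at the stages, once embedded, form an increasing chain; its supremum is the
    -- required join.
    have hmono : Monotone fun n => (bilimIn F n).emb (z n) := fun n m h => (hz' n _).2
      ⟨(bilimIn_emb_proj_mono x h).trans ((hz' m _).1 le_rfl).1,
        (bilimIn_emb_proj_mono y h).trans ((hz' m _).1 le_rfl).2⟩
    have hs := hmono.directed_le.directedOn_range.isLUB_sSup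
    refine ⟨_, isLUB_pair_iff.2 fun v => ⟨fun h => ⟨bilimIn_le _ _ fun n => ?_,
      bilimIn_le _ _ fun n => ?_⟩, fun h => hs.2 ?_⟩⟩
    · exact ((hz' n _).1 le_rfl).1.trans ((hs.1 ⟨n, rfl⟩).trans h)
    · exact ((hz' n _).1 le_rfl).2.trans ((hs.1 ⟨n, rfl⟩).trans h)
    · rintro _ ⟨n, rfl⟩
      exact (hz' n v).2 ⟨((bilimIn F n).emb_proj x).trans h.1, ((bilimIn F n).emb_proj y).trans h.2⟩
  le_of_compact x u h := bilimIn_le _ _ fun n => (EP.emb_le_iff _ _ _).2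
    ((hF n).le_of_compact _ _ fun c hc hcx => (EP.emb_le_iff _ _ _).1
      (h _ (EP.isCompactElement_emb _ hc) ((EP.emb_le_iff _ _ _).2 hcx)))

end Bilimit

theorem isScottDomain_iterObj {n : ℕ} {τ : Ty (n + 1)}
    (h : ∀ X : Fin (n + 1) → Cpo, (∀ i, IsScottDomain (X i)) → IsScottDomain ((interp τ).obj X))
    {X : Fin n → Cpo} (hX : ∀ i, IsScottDomain (X i)) (m : ℕ) :
    IsScottDomain (iterObj (consF n ⋙ interp τ) X m) := by
  induction m with
  | zero => exact isScottDomain_one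
  | succ m ih => exact h _ fun i => by refine Fin.cases ih hX i

/-- Type expressions map Scott domains to Scott domains. -/
theorem isScottDomain_interp {n : ℕ} (τ : Ty n) (X : Fin n → Cpo)
    (hX : ∀ i, IsScottDomain (X i)) : IsScottDomain ((interp τ).obj X) := by
  induction τ with
  | var i => exact hX i
  | unit => exact isScottDomain_two
  | prod σ τ h1 h2 => exact isScottDomain_prod (h1 X hX) (h2 X hX)
  | arrow σ τ h1 h2 => exact isScottDomain_arrow (h1 X hX) (h2 X hX)
  | sum σ τ h1 h2 => exact isScottDomain_sum (h1 X hX) (h2 X hX)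
  | mu τ h =>
    exact isScottDomain_bilim (F := (iterChain (consF _ ⋙ interp τ)).obj X)
      (isScottDomain_iterObj h hX)

theorem isScottDomain_sem (τ : Ty 0) : IsScottDomain (sem τ) :=
  isScottDomain_interp τ _ fun i => i.elim0

/-! ## Local continuity and the unfolding isomorphism -/

/-- The idempotents of the embedding-projection pairs `e k` increase to the identity. -/
structure Exhausts {X : ℕ → Cpo} {Y : Cpo} (e : ∀ k, X k ⟶ Y) : Prop where
  mono : ∀ y, Monotone fun k => (e k).emb ((e k).proj y)
  le : ∀ y u, (∀ k, (e k).emb ((e k).proj y) ≤ u) → y ≤ u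

theorem exhausts_id (Y : Cpo) : Exhausts fun _ : ℕ => 𝟙 Y :=
  ⟨fun _ _ _ _ => le_rfl, fun _ _ h => h 0⟩

theorem exhausts_bilimIn (F : ℕ ⥤ Cpo) : Exhausts fun n => bilimIn F n :=
  ⟨bilimIn_emb_proj_mono, bilimIn_le⟩

theorem Exhausts.map_le {X : ℕ → Cpo} {Y Z : Cpo} {e : ∀ k, X k ⟶ Y} (he : Exhausts e)
    (f : ScottMap Y Z) (y : Y) (u : Z) (h : ∀ k, f ((e k).emb ((e k).proj y)) ≤ u) : f y ≤ u :=
  f.map_le (Set.range_nonempty _) (he.mono y).directed_le.directedOn_range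
    ⟨by rintro _ ⟨k, rfl⟩; exact (e k).emb_proj y, fun u hu => he.le y u fun k => hu ⟨k, rfl⟩⟩
    (by rintro _ ⟨k, rfl⟩; exact h k)

theorem Exhausts.prod {X X' : ℕ → Cpo} {Y Y' : Cpo} {e : ∀ k, X k ⟶ Y} {e' : ∀ k, X' k ⟶ Y'}
    (he : Exhausts e) (he' : Exhausts e') :
    Exhausts fun k => prodF.map (Prod.mkHom (e k) (e' k)) :=
  ⟨fun y _ _ h => ⟨he.mono y.1 h, he'.mono y.2 h⟩,
    fun y u h => ⟨he.le y.1 u.1 fun k => (h k).1, he'.le y.2 u.2 fun k => (h k).2⟩⟩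

theorem Exhausts.sum {X X' : ℕ → Cpo} {Y Y' : Cpo} {e : ∀ k, X k ⟶ Y} {e' : ∀ k, X' k ⟶ Y'}
    (he : Exhausts e) (he' : Exhausts e') :
    Exhausts fun k => sumF.map (Prod.mkHom (e k) (e' k)) where
  mono z k l h := by
    rcases sumObj_cases z with rfl | ⟨x, rfl⟩ | ⟨y, rfl⟩
    · exact bot_le
    · exact (sumInl_le_sumInl _ _).2 (he.mono x h)
    · exact (sumInr_le_sumInr _ _).2 (he'.mono y h)
  le z u h := by
    rcases sumObj_cases z with rfl | ⟨x, rfl⟩ | ⟨y, rfl⟩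
    · exact bot_le
    -- A single index suffices to see that `u` lies in the same summand.
    · obtain ⟨u, rfl⟩ := (isSummand_sumInl Y Y').upper _ _ (h 0)
      exact (sumInl_le_sumInl _ _).2 (he.le x u fun k => (sumInl_le_sumInl _ _).1 (h k))
    · obtain ⟨u, rfl⟩ := (isSummand_sumInr Y Y').upper _ _ (h 0)
      exact (sumInr_le_sumInr _ _).2 (he'.le y u fun k => (sumInr_le_sumInr _ _).1 (h k))

theorem Exhausts.arrow {X X' : ℕ → Cpo} {Y Y' : Cpo} {e : ∀ k, X k ⟶ Y} {e' : ∀ k, X' k ⟶ Y'}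
    (he : Exhausts e) (he' : Exhausts e') :
    Exhausts fun k => arrowF.map (Prod.mkHom (e k) (e' k)) where
  mono f k l h := fun x => (he'.mono _ h).trans
    ((EP.emb (e' l)).mono ((EP.proj (e' l)).mono (ScottMap.mono f (he.mono x h))))
  le f u h := arrow_le.2 fun x => he.map_le (f : ScottMap Y Y') x _ fun k =>
    he'.le _ _ fun l => by
      -- The argument is truncated at `k` and the value at `l`; the diagonal index `max k l`
      -- dominates both.
      refine le_trans ?_ (h (max k l) x)
      exact (he'.mono _ (le_max_right k l)).trans ((EP.emb (e' _)).mono ((EP.proj (e' _)).mono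
        (ScottMap.mono f (he.mono x (le_max_left k l)))))

theorem bilimIn_comp_map {F G : ℕ ⥤ Cpo} (α : F ⟶ G) (n : ℕ) :
    bilimIn F n ≫ bilim.map α = α.app n ≫ bilimIn G n :=
  (bilimIsColimit F).fac ⟨bilimObj G, α ≫ (bilimCocone G).ι⟩ n

theorem Exhausts.bilim {F : ℕ → ℕ ⥤ Cpo} {G : ℕ ⥤ Cpo} (α : ∀ k, F k ⟶ G)
    (h : ∀ n, Exhausts fun k => (α k).app n) : Exhausts fun k => DomainLogic.bilim.map (α k) := by
  -- Naturality makes truncation at stage `n` compatible with the idempotent of `α k`, so the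
  -- suprema over `n` and over `k` can be interchanged.
  have key : ∀ k n (y : bilimObj G),
      EP.emb (DomainLogic.bilim.map (α k)) ((bilimIn (F k) n).emb
        ((bilimIn (F k) n).proj (EP.proj (DomainLogic.bilim.map (α k)) y))) =
      (bilimIn G n).emb (EP.emb ((α k).app n) (EP.proj ((α k).app n) (y.1 n))) := by
    intro k n y
    have h1 := congrArg (fun f => EP.emb f (EP.proj ((α k).app n) (y.1 n)))
      (bilimIn_comp_map (α k) n)
    exact h1
  refine ⟨fun y k l hkl => ?_, fun y u hu n => ?_⟩
  · refine (exhausts_bilimIn (F k)).map_le (EP.emb (DomainLogic.bilim.map (α k))) _ _ fun n => ?_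
    exact (key k n y).le.trans (((bilimIn G n).emb.mono ((h n).mono (y.1 n) hkl)).trans
      ((key l n y).symm.le.trans ((EP.emb (DomainLogic.bilim.map (α l))).mono (EP.emb_proj _ _))))
  · refine (h n).le _ _ fun k => ?_
    have h1 := (key k n y).symm.le.trans
      (((EP.emb (DomainLogic.bilim.map (α k))).mono (EP.emb_proj _ _)).trans (hu k))
    exact (EP.emb_le_iff _ _ _).1 h1

theorem exhausts_consF {n : ℕ} {X : ℕ → Fin n → Cpo} {Y : Fin n → Cpo} {e : ∀ k, X k ⟶ Y}
    (he : ∀ i, Exhausts fun k => e k i) {A : ℕ → Cpo} {B : Cpo} {a : ∀ k, A k ⟶ B}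
    (ha : Exhausts a) (i : Fin (n + 1)) :
    Exhausts fun k => (consF n).map (X := (X k, A k)) (Y := (Y, B)) (Prod.mkHom (e k) (a k)) i := by
  refine Fin.cases ha he i

/-- Type expressions are locally continuous. -/
theorem exhausts_interp {n : ℕ} (τ : Ty n) {X : ℕ → Fin n → Cpo} {Y : Fin n → Cpo}
    (e : ∀ k, X k ⟶ Y) (he : ∀ i, Exhausts fun k => e k i) :
    Exhausts fun k => (interp τ).map (e k) := by
  induction τ with
  | var i => exact he i
  | unit => exact exhausts_id _
  | prod σ τ h1 h2 => exact (h1 e he).prod (h2 e he)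
  | arrow σ τ h1 h2 => exact (h1 e he).arrow (h2 e he)
  | sum σ τ h1 h2 => exact (h1 e he).sum (h2 e he)
  | mu τ h =>
    refine Exhausts.bilim (fun k => (iterChain (consF _ ⋙ interp τ)).map (e k)) fun m => ?_
    change Exhausts fun k => iterMap (consF _ ⋙ interp τ) (e k) m
    -- Stage `m + 1` is the body `τ` at stage `m`, so the hypothesis on `τ` applies in the
    -- environment extended by that stage.
    induction m with
    | zero => exact exhausts_id _
    | succ m ih => exact h _ (exhausts_consF he ih)

theorem comp_emb_proj_le {X Y Z : Cpo} (f : X ⟶ Y) (g : Y ⟶ Z) (z : Z) :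
    EP.emb (f ≫ g) (EP.proj (f ≫ g) z) ≤ EP.emb g (EP.proj g z) :=
  (EP.emb g).mono (EP.emb_proj f _)

/-- In general the projection is only the right adjoint of the embedding; for an isomorphism it is
the left adjoint as well, which is what `unfold` requires. -/
theorem EP.proj_le_iff {X Y : Cpo} (f : X ⟶ Y)
    (hf : ∀ y, EP.emb f (EP.proj f y) = y) (y : Y) (x : X) :
    EP.proj f y ≤ x ↔ y ≤ EP.emb f x := by
  rw [← EP.emb_le_emb f, hf]

section Unfold

universe v u

variable {B : Type u} [Category.{v} B] (G : B × Cpo ⥤ Cpo)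

/-- The universal property at index `n + 1`. The shift occurs because one unfolding consumes one
application of `G`. -/
theorem bilimIn_comp_unfoldEP (b : B) (n : ℕ) :
    bilimIn ((iterChain G).obj b) (n + 1) ≫ unfoldEP G b =
      G.map (Prod.mkHom (𝟙 b) (bilimIn ((iterChain G).obj b) n)) :=
  (bilimIsColimit ((iterChain G).obj b)).fac (unfoldCocone G b) (n + 1)

end Unfold

/-- By local continuity `y` is the supremum of its truncations along `G` applied to the stage
injections. Each of these factors through `unfoldEP`, hence lies below the left-hand side. -/
theorem unfoldEP_emb_proj {n : ℕ} (τ : Ty (n + 1)) (X : Fin n → Cpo)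
    (y : (consF n ⋙ interp τ).obj (X, (interp τ.mu).obj X)) :
    EP.emb (unfoldEP (consF n ⋙ interp τ) X) (EP.proj (unfoldEP (consF n ⋙ interp τ) X) y) = y := by
  refine le_antisymm (EP.emb_proj _ y) ?_
  refine (exhausts_interp τ _ (exhausts_consF (fun i => exhausts_id (X i))
    (exhausts_bilimIn ((iterChain (consF n ⋙ interp τ)).obj X)))).le _ _ fun k => ?_
  have h := bilimIn_comp_unfoldEP (consF n ⋙ interp τ) X k
  change EP.emb ((consF n ⋙ interp τ).map (Prod.mkHom (𝟙 X)
    (bilimIn ((iterChain (consF n ⋙ interp τ)).obj X) k))) (EP.proj ((consF n ⋙ interp τ).map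
      (Prod.mkHom (𝟙 X) (bilimIn ((iterChain (consF n ⋙ interp τ)).obj X) k))) y) ≤ _
  rw [← h]
  exact comp_emb_proj_le _ _ y

theorem eqToHom_emb_proj {X Y : Cpo} (h : X = Y) (y : Y) :
    EP.emb (eqToHom h) (EP.proj (eqToHom h) y) = y := by
  subst h
  rfl

/-- The map `unfold` is an isomorphism; in particular, it has a left adjoint. -/
theorem unfold_adjoint (τ : Ty 1) : ∃ f : sem τ.unfolding → sem τ.mu,
    ∀ x y, f x ≤ y ↔ x ≤ unfold τ y :=
  ⟨_, EP.proj_le_iff (unfoldEP (consF 0 ⋙ interp τ) (fun i => i.elim0) ≫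
      eqToHom (interp_unfolding τ _)) fun x =>
    (congrArg (EP.emb (eqToHom (interp_unfolding τ _))) (unfoldEP_emb_proj τ _ _)).trans
      (eqToHom_emb_proj (interp_unfolding τ _) x)⟩

/-! ## Formulae denote principal filters of compact elements -/

theorem Form.exists_compact {τ : Ty 0} (δ : Form τ) (hδ : δ.sem.Nonempty) :
    ∃ d : DomainLogic.sem τ, IsCompactElement d ∧ δ.sem = Set.Ici d := by
  induction δ with
  | top => exact ⟨⊥, isCompactElement_bot _, Set.Ici_bot.symm⟩
  | bot => exact absurd hδ Set.not_nonempty_empty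
  | @and τ φ ψ h1 h2 =>
    obtain ⟨x, hx⟩ := hδ
    obtain ⟨d, hd, h1⟩ := h1 ⟨x, hx.1⟩
    obtain ⟨e, he, h2⟩ := h2 ⟨x, hx.2⟩
    obtain ⟨z, hz⟩ := (isScottDomain_sem τ).exists_isLUB d e x 
      (Set.mem_Ici.1 (h1 ▸ hx.1)) (Set.mem_Ici.1 (h2 ▸ hx.2))
    refine ⟨z, isCompactElement_of_isLUB hd he hz, ?_⟩
    ext y
    rw [Form.sem, h1, h2]
    exact (isLUB_pair_iff.1 hz y).symm
  | unit =>
    refine ⟨_, isCompactElement_two_true, ?_⟩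
    ext (p : Prop)
    exact ⟨fun h _ => (show p = True from h) ▸ trivial, fun h => eq_true (h trivial)⟩
  | @fst σ τ φ h =>
    obtain ⟨x, hx⟩ := hδ
    obtain ⟨d, hd, h⟩ := h ⟨_, hx⟩
    refine ⟨pair d ⊥, isCompactElement_pair_bot hd, ?_⟩
    ext y
    rw [Form.sem, h]
    exact (pair_bot_le d y).symm
  | @snd σ τ φ h =>
    obtain ⟨x, hx⟩ := hδ
    obtain ⟨d, hd, h⟩ := h ⟨_, hx⟩
    refine ⟨pair ⊥ d, isCompactElement_bot_pair hd, ?_⟩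
    ext y
    rw [Form.sem, h]
    exact (bot_pair_le d y).symm
  | @fold τ φ h =>
    obtain ⟨x, hx⟩ := hδ
    obtain ⟨d, hd, h⟩ := h ⟨_, hx⟩
    obtain ⟨f, hf⟩ := unfold_adjoint τ
    refine ⟨f d, isCompactElement_of_adjoint (unfold τ) hf hd, ?_⟩
    ext y
    rw [Form.sem, h]
    exact (hf d y).symm
  | @inl σ τ φ h =>
    obtain ⟨_, x, hx, rfl⟩ := hδ
    obtain ⟨d, hd, h⟩ := h ⟨_, hx⟩
    refine ⟨sumInl d, (isSummand_sumInl _ _).isCompactElement hd, ?_⟩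
    rw [Form.sem, h]
    exact (isSummand_sumInl _ _).image_Ici d
  | @inr σ τ φ h =>
    obtain ⟨_, x, hx, rfl⟩ := hδ
    obtain ⟨d, hd, h⟩ := h ⟨_, hx⟩
    refine ⟨sumInr d, (isSummand_sumInr _ _).isCompactElement hd, ?_⟩
    rw [Form.sem, h]
    exact (isSummand_sumInr _ _).image_Ici d
  | @imp σ τ ψ φ h1 h2 =>
    obtain ⟨f, hf⟩ := hδ
    -- An unsatisfiable antecedent imposes no condition. Otherwise any point of it is sent by `f`
    -- into `φ`, so the hypothesis for `φ` becomes available.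
    rcases ψ.sem.eq_empty_or_nonempty with hψ | hψ
    · refine ⟨⊥, isCompactElement_bot _, ?_⟩
      rw [Set.Ici_bot, Form.sem, hψ]
      exact Set.eq_univ_of_forall fun _ _ h => absurd h (Set.notMem_empty _)
    · obtain ⟨a, ha, h1⟩ := h1 hψ
      obtain ⟨x, hx⟩ := hψ
      obtain ⟨b, hb, h2⟩ := h2 ⟨_, hf x hx⟩
      refine ⟨step ha b, isCompactElement_step ha hb, ?_⟩
      ext g
      rw [Form.sem, h1, h2]
      -- By monotonicity of `g`, the condition on all `x ≥ a` reduces to the one at `a`.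
      exact ⟨fun h => (step_le ha b g).2 (h a le_rfl),
        fun h x hx => ((step_le ha b g).1 h).trans (app_mono g hx)⟩

/-! ## Substitution lemmas -/

namespace Ty

theorem liftRen_comp {n m k : ℕ} (ρ : Fin n → Fin m) (ρ' : Fin m → Fin k) :
    (fun i => liftRen ρ' (liftRen ρ i)) = liftRen fun i => ρ' (ρ i) :=
  funext fun i => by refine Fin.cases ?_ (fun i => ?_) i <;> rfl

theorem rename_rename {n : ℕ} (τ : Ty n) : ∀ {m k : ℕ} (ρ : Fin n → Fin m) (ρ' : Fin m → Fin k),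
    rename ρ' (rename ρ τ) = rename (fun i => ρ' (ρ i)) τ := by
  induction τ with
  | var i => intros; rfl
  | unit => intros; rfl
  | prod σ τ h1 h2 => intros; simp only [rename, h1, h2]
  | arrow σ τ h1 h2 => intros; simp only [rename, h1, h2]
  | sum σ τ h1 h2 => intros; simp only [rename, h1, h2]
  | mu τ h => intros; simp only [rename, h, liftRen_comp]

theorem liftSub_liftRen {n m k : ℕ} (ρ : Fin n → Fin m) (t : Fin m → Ty k) :
    (fun i => liftSub t (liftRen ρ i)) = liftSub fun i => t (ρ i) :=
  funext fun i => by refine Fin.cases ?_ (fun i => ?_) i <;> rfl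

theorem subst_rename {n : ℕ} (τ : Ty n) : ∀ {m k : ℕ} (ρ : Fin n → Fin m) (t : Fin m → Ty k),
    subst t (rename ρ τ) = subst (fun i => t (ρ i)) τ := by
  induction τ with
  | var i => intros; rfl
  | unit => intros; rfl
  | prod σ τ h1 h2 => intros; simp only [rename, subst, h1, h2]
  | arrow σ τ h1 h2 => intros; simp only [rename, subst, h1, h2]
  | sum σ τ h1 h2 => intros; simp only [rename, subst, h1, h2]
  | mu τ h => intros; simp only [rename, subst, h, liftSub_liftRen]

theorem rename_liftSub {n m k : ℕ} (s : Fin n → Ty m) (ρ : Fin m → Fin k) :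
    (fun i => rename (liftRen ρ) (liftSub s i)) = liftSub fun i => rename ρ (s i) :=
  funext fun i => by
    refine Fin.cases rfl (fun i => ?_) i
    change rename (liftRen ρ) (rename Fin.succ (s i)) = rename Fin.succ (rename ρ (s i))
    rw [rename_rename, rename_rename]
    rfl

theorem rename_subst {n : ℕ} (τ : Ty n) : ∀ {m k : ℕ} (s : Fin n → Ty m) (ρ : Fin m → Fin k),
    rename ρ (subst s τ) = subst (fun i => rename ρ (s i)) τ := by
  induction τ with
  | var i => intros; rfl
  | unit => intros; rfl
  | prod σ τ h1 h2 => intros; simp only [rename, subst, h1, h2]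
  | arrow σ τ h1 h2 => intros; simp only [rename, subst, h1, h2]
  | sum σ τ h1 h2 => intros; simp only [rename, subst, h1, h2]
  | mu τ h => intros; simp only [rename, subst, h, rename_liftSub]

theorem subst_liftSub {n m k : ℕ} (s : Fin n → Ty m) (t : Fin m → Ty k) :
    (fun i => subst (liftSub t) (liftSub s i)) = liftSub fun i => subst t (s i) :=
  funext fun i => by
    refine Fin.cases rfl (fun i => ?_) i
    change subst (liftSub t) (rename Fin.succ (s i)) = rename Fin.succ (subst t (s i))
    rw [subst_rename, rename_subst]
    rfl

/-- The binder case rests on `subst_liftSub`, which needs the two mixed laws `subst_rename` and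
`rename_subst` because lifting a substitution renames its values. -/
theorem subst_subst {n : ℕ} (τ : Ty n) : ∀ {m k : ℕ} (s : Fin n → Ty m) (t : Fin m → Ty k),
    subst t (subst s τ) = subst (fun i => subst t (s i)) τ := by
  induction τ with
  | var i => intros; rfl
  | unit => intros; rfl
  | prod σ τ h1 h2 => intros; simp only [subst, h1, h2]
  | arrow σ τ h1 h2 => intros; simp only [subst, h1, h2]
  | sum σ τ h1 h2 => intros; simp only [subst, h1, h2]
  | mu τ h => intros; simp only [subst, h, subst_liftSub]

theorem liftSub_var (n : ℕ) : liftSub (var : Fin n → Ty n) = var :=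
  funext fun i => by refine Fin.cases ?_ (fun i => ?_) i <;> rfl

theorem subst_var {n : ℕ} (τ : Ty n) : subst var τ = τ := by
  induction τ with
  | var i => rfl
  | unit => rfl
  | prod σ τ h1 h2 => simp only [subst, h1, h2]
  | arrow σ τ h1 h2 => simp only [subst, h1, h2]
  | sum σ τ h1 h2 => simp only [subst, h1, h2]
  | mu τ h => simp only [subst, liftSub_var, h]

/-- Identifies the type at which the induction hypothesis for the body `τ` yields a formula with the
type expected under `Form.fold`. -/
theorem unfolding_subst {n m : ℕ} (τ : Ty (n + 1)) (s : Fin n → Ty m) :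
    unfolding (subst (liftSub s) τ) = subst (Fin.cases (subst s (mu τ)) s) τ := by
  unfold unfolding
  rw [subst_subst]
  congr 1
  funext i
  refine Fin.cases rfl (fun i => ?_) i
  change subst (single _) (rename Fin.succ (s i)) = s i
  rw [subst_rename]
  exact subst_var (s i)

end Ty

/-! ## Every compact element is definable -/

/-- The principal filter of `d : Y`, where `Y` is the interpretation of `σ`, is the denotation of
a formula of type `σ`. -/
def Definable (σ : Ty 0) (Y : Cpo) (h : sem σ = Y) (d : Y) : Prop :=
  ∃ δ : Form σ, Set.Ici d = h ▸ δ.sem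

namespace Definable

theorem of_form {σ : Ty 0} {d : sem σ} (δ : Form σ) (h : ∀ x, x ∈ δ.sem ↔ d ≤ x) :
    Definable σ (sem σ) rfl d := ⟨δ, Set.ext fun x => (h x).symm⟩

theorem form {σ : Ty 0} {d : sem σ} (h : Definable σ (sem σ) rfl d) :
    ∃ δ : Form σ, ∀ x, x ∈ δ.sem ↔ d ≤ x :=
  h.imp fun δ (hδ : Set.Ici d = δ.sem) x => by rw [← hδ, Set.mem_Ici]

theorem congr_type {σ σ' : Ty 0} (h : σ = σ') {Y : Cpo} {hY : sem σ = Y} {d : Y}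
    (hd : Definable σ Y hY d) : Definable σ' Y (h ▸ hY) d := by
  subst h
  exact hd

variable {σ τ : Ty 0} {Y Z : Cpo} {hY : sem σ = Y} {hZ : sem τ = Z}

theorem bot (σ : Ty 0) (Y : Cpo) (hY : sem σ = Y) : Definable σ Y hY ⊥ := by
  subst hY
  exact of_form .top fun x => iff_of_true trivial bot_le

theorem isLUB {x y z : Y} (hx : Definable σ Y hY x) (hy : Definable σ Y hY y)
    (hz : IsLUB {x, y} z) : Definable σ Y hY z := by
  subst hY
  obtain ⟨φ, hφ⟩ := hx.form
  obtain ⟨ψ, hψ⟩ := hy.form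
  exact of_form (.and φ ψ) fun u =>
    (and_congr (hφ u) (hψ u)).trans (isLUB_pair_iff.1 hz u).symm

theorem unit (d : two) (h : sem .unit = two) : Definable .unit two h d := by
  rcases Classical.em d with hd | hd
  · exact of_form .unit fun (x : Prop) =>
      ⟨fun (hx : x = True) _ => hx ▸ trivial, fun hx => eq_true (hx hd)⟩
  · have : d = ⊥ := le_bot_iff.1 fun h => absurd h hd
    exact this ▸ bot _ _ _

theorem prod {y : Y} {z : Z} (hy : Definable σ Y hY y) (hz : Definable τ Z hZ z)
    (h : sem (.prod σ τ) = prodObj Y Z) : Definable (.prod σ τ) (prodObj Y Z) h (pair y z) := by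
  subst hY hZ
  obtain ⟨φ, hφ⟩ := hy.form
  obtain ⟨ψ, hψ⟩ := hz.form
  exact of_form (.and (.fst φ) (.snd ψ)) fun x => and_congr (hφ _) (hψ _)

theorem inl {y : Y} (hy : Definable σ Y hY y) (h : sem (.sum σ τ) = sumObj Y Z)
    (hZ : sem τ = Z) : Definable (.sum σ τ) (sumObj Y Z) h (sumInl y) := by
  subst hY hZ
  obtain ⟨φ, hφ⟩ := hy.form
  exact of_form (.inl φ) fun x => by
    rw [Form.sem, Set.ext hφ]
    exact Set.ext_iff.1 ((isSummand_sumInl (sem σ) (sem τ)).image_Ici y) x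

theorem inr {z : Z} (hz : Definable τ Z hZ z) (h : sem (.sum σ τ) = sumObj Y Z)
    (hY : sem σ = Y) : Definable (.sum σ τ) (sumObj Y Z) h (sumInr z) := by
  subst hY hZ
  obtain ⟨φ, hφ⟩ := hz.form
  exact of_form (.inr φ) fun x => by
    rw [Form.sem, Set.ext hφ]
    exact Set.ext_iff.1 ((isSummand_sumInr (sem σ) (sem τ)).image_Ici z) x

/-- The step function enters only through its adjunction, so that images of step functions under
embeddings are covered too. -/
theorem arrow {y : Y} {z : Z} (hy : Definable σ Y hY y) (hz : Definable τ Z hZ z)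
    (h : sem (.arrow σ τ) = arrowObj Y Z) {f : arrowObj Y Z}
    (hf : ∀ g, f ≤ g ↔ z ≤ app g y) : Definable (.arrow σ τ) (arrowObj Y Z) h f := by
  subst hY hZ
  obtain ⟨φ, hφ⟩ := hy.form
  obtain ⟨ψ, hψ⟩ := hz.form
  exact of_form (.imp φ ψ) fun g => Iff.trans
    ⟨fun (hg : ∀ x ∈ φ.sem, app g x ∈ ψ.sem) => (hψ _).1 (hg y ((hφ y).2 le_rfl)),
      fun hg x hx => (hψ _).2 (hg.trans (app_mono g ((hφ x).1 hx)))⟩ (hf g).symm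

theorem eqToHom_emb {X : Cpo} (h : X = Y) {hX : sem σ = X} {x : X}
    (hx : Definable σ X hX x) : Definable σ Y (hX.trans h) (EP.emb (eqToHom h) x) := by
  subst h
  exact hx

/-- If the unfolding of an element of a recursive type is definable, then so is the element. -/
theorem fold {τ : Ty 1} {d : sem τ.mu}
    (hd : Definable τ.unfolding _ (interp_unfolding τ _).symm
      (EP.emb (unfoldEP (consF 0 ⋙ interp τ) (fun i => i.elim0)) d)) :
    Definable τ.mu (sem τ.mu) rfl d := by
  obtain ⟨φ, hφ⟩ := (hd.eqToHom_emb (interp_unfolding τ _)).form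
  exact of_form (.fold φ) fun x => (hφ _).trans (EP.emb_le_emb
    (unfoldEP (consF 0 ⋙ interp τ) (fun i => i.elim0) ≫ eqToHom (interp_unfolding τ _)) d x)

end Definable

/-- For a functor `G` and a cocone `i` over the iterates of `G` at `c`, with vertex `Y` that
interprets the recursive type `rec X. τ`: definability at the unfolded type implies definability
at the recursive type. -/
def FoldDefinable.{v, u} {B : Type u} [Category.{v} B] (τ : Ty 1) (G : B × Cpo ⥤ Cpo) (c : B)
    (Y : Cpo) (i : ∀ m, iterObj G c m ⟶ Y) : Prop :=
  ∀ (h : sem τ.mu = Y) (h' : sem τ.unfolding = G.obj (c, Y)) (m : ℕ) (x : iterObj G c (m + 1)),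
    Definable τ.unfolding _ h' (EP.emb (G.map (Prod.mkHom (𝟙 c) (i m))) x) →
    Definable τ.mu Y h (EP.emb (i (m + 1)) x)

/-- The functor is a variable `K`, equal to the interpretation, so that a different presentation of
it can be substituted later. -/
theorem foldDefinable_interp (τ : Ty 1) (K : (Fin 0 → Cpo) × Cpo ⥤ Cpo)
    (hK : consF 0 ⋙ interp τ = K) :
    FoldDefinable τ K (fun i => i.elim0) _
      (bilimIn (Functor.ofSequence (iterStep K (fun i => i.elim0)))) := by
  subst hK
  intro h h' m x hx
  refine Definable.fold ?_
  have := congrArg (fun f => EP.emb f x)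
    (bilimIn_comp_unfoldEP (consF 0 ⋙ interp τ) (fun i => i.elim0) m)
  have h2 : EP.emb (unfoldEP (consF 0 ⋙ interp τ) (fun i => i.elim0))
    ((bilimIn ((iterChain (consF 0 ⋙ interp τ)).obj (fun i => i.elim0)) (m + 1)).emb x) = _ := this
  exact h2.symm ▸ hx

theorem map_id_precomp.{v, u} {B B' : Type u} [Category.{v} B] [Category.{v} B']
    (G : B × Cpo ⥤ Cpo) (H : B' ⥤ B) (b : B') {X Y : Cpo} (f : X ⟶ Y) :
    (H.prod (𝟭 Cpo) ⋙ G).map (Prod.mkHom (𝟙 b) f) = G.map (Prod.mkHom (𝟙 (H.obj b)) f) := by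
  rw [← H.map_id]
  rfl

/-- Substituting closed types amounts to precomposing the parameter of the functor with `subF s`,
which reduces the claim to the closed case. -/
theorem foldDefinable_subst {n : ℕ} (τ : Ty (n + 1)) (s : Fin n → Ty 0) :
    FoldDefinable (τ.subst (Ty.liftSub s)) (consF n ⋙ interp τ) (fun i => sem (s i)) _
      (bilimIn (Functor.ofSequence (iterStep (consF n ⋙ interp τ) (fun i => sem (s i))))) := by
  have h1 := foldDefinable_interp (τ.subst (Ty.liftSub s))
    ((subF s).prod (𝟭 Cpo) ⋙ consF n ⋙ interp τ) (by
      rw [interp_subst, ← Functor.assoc, cons_subF, Functor.assoc])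
  -- The two chains have definitionally equal objects; only their connecting maps need rewriting.
  rw [iterStep_precomp] at h1
  intro h h' m x hx
  exact h1 h h' m x ((congrArg (Definable _ _ h') (congrArg (fun f => EP.emb f x)
    (map_id_precomp (consF n ⋙ interp τ) (subF s) _ _))).mpr hx)

/-! ### Definability for open type expressions -/

theorem sem_subst {n : ℕ} (τ : Ty n) (s : Fin n → Ty 0) (Y : Fin n → Cpo)
    (hY : ∀ i, sem (s i) = Y i) : sem (τ.subst s) = (interp τ).obj Y := by
  obtain rfl : (fun i => sem (s i)) = Y := funext hY
  unfold sem
  rw [interp_subst]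
  rfl

/-- A directed set in `X` is tested against `p` after pairing it with the fixed second component
`p.2`. -/
theorem isCompactElement_fst {X Y : Cpo} {p : prodObj X Y} (hp : IsCompactElement p) :
    IsCompactElement p.1 := by
  intro D u hne hD hu h
  obtain ⟨_, ⟨x, hx, rfl⟩, hpx⟩ := hp ((fun x => pair x p.2) '' D) (pair u p.2) (hne.image _)
    (ScottMap.directed_image (f := fun x => pair x p.2) (fun _ _ h => pair_le.2 ⟨h, le_rfl⟩) hD)
    ⟨by rintro _ ⟨x, hx, rfl⟩; exact ⟨hu.1 hx, le_rfl⟩,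
      fun v hv => ⟨hu.2 fun x hx => (hv ⟨x, hx, rfl⟩).1, hne.elim fun x hx => (hv ⟨x, hx, rfl⟩).2⟩⟩
    ⟨h, le_rfl⟩
  exact ⟨x, hx, hpx.1⟩

theorem isCompactElement_snd {X Y : Cpo} {p : prodObj X Y} (hp : IsCompactElement p) :
    IsCompactElement p.2 := by
  intro D u hne hD hu h
  obtain ⟨_, ⟨y, hy, rfl⟩, hpy⟩ := hp ((fun y => pair p.1 y) '' D) (pair p.1 u) (hne.image _)
    (ScottMap.directed_image (f := fun y => pair p.1 y) (fun _ _ h => pair_le.2 ⟨le_rfl, h⟩) hD)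
    ⟨by rintro _ ⟨y, hy, rfl⟩; exact ⟨le_rfl, hu.1 hy⟩,
      fun v hv => ⟨hne.elim fun y hy => (hv ⟨y, hy, rfl⟩).1, hu.2 fun y hy => (hv ⟨y, hy, rfl⟩).2⟩⟩
    ⟨le_rfl, h⟩
  exact ⟨y, hy, hpy.2⟩

/-- The embedding of a step function is a step function. -/
theorem arrowF_map_step_le {X X' Y Y' : Cpo} (e : X ⟶ X') (e' : Y ⟶ Y') {a : X}
    (ha : IsCompactElement a) (b : Y) (g : arrowObj X' Y') :
    EP.emb (X := arrowObj X Y) (Y := arrowObj X' Y') (arrowF.map (Prod.mkHom e e'))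
      (step ha b) ≤ g ↔ EP.emb e' b ≤ app g (EP.emb e a) :=
  (EP.emb_le_iff _ _ _).trans ((step_le ha b _).trans (EP.emb_le_iff _ _ _).symm)

/-- Given embeddings of the Scott domains `X i` into the interpretations of the types `s i`, under
which the compact elements become definable, the same holds for every type expression. -/
theorem definable_map {n : ℕ} (τ : Ty n) (s : Fin n → Ty 0) {X Y : Fin n → Cpo}
    (hX : ∀ i, IsScottDomain (X i)) (hY : ∀ i, sem (s i) = Y i) (e : X ⟶ Y)
    (he : ∀ i (d : X i), IsCompactElement d → Definable (s i) (Y i) (hY i) (EP.emb (e i) d))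
    (d : (interp τ).obj X) (hd : IsCompactElement d) :
    Definable (τ.subst s) ((interp τ).obj Y) (sem_subst τ s Y hY)
      (EP.emb ((interp τ).map e) d) := by
  induction τ with
  | var i => exact he i d hd
  | unit => exact Definable.unit _ _
  | prod σ τ h1 h2 =>
    exact (h1 s hX hY e he _ (isCompactElement_fst hd)).prod
      (h2 s hX hY e he _ (isCompactElement_snd hd)) _
  | sum σ τ h1 h2 =>
    rcases sumObj_cases d with rfl | ⟨x, rfl⟩ | ⟨y, rfl⟩
    · exact Definable.bot _ _ _
    · exact (h1 s hX hY e he x ((isSummand_sumInl _ _).of_isCompactElement hd)).inl _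
        (sem_subst τ s Y hY)
    · exact (h2 s hX hY e he y ((isSummand_sumInr _ _).of_isCompactElement hd)).inr _
        (sem_subst σ s Y hY)
  | arrow σ τ h1 h2 =>
    have hσ := isScottDomain_interp σ X hX
    have hτ := isScottDomain_interp τ X hX
    -- Definability of the image holds for `⊥` and for compact steps, and passes to joins because an
    -- embedding, being a left adjoint, preserves them.
    refine (isScottDomain_arrow hσ hτ).compact_induction (le_of_step hσ hτ)
      (P := fun f => Definable _ _ (sem_subst (.arrow σ τ) s Y hY)
        (EP.emb ((interp (.arrow σ τ)).map e) f)) ?_ ?_ ?_ hd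
    · exact (EP.emb_bot ((interp (.arrow σ τ)).map e)).symm ▸ Definable.bot _ _ _
    · rintro _ ⟨a, ha, b, hb, rfl⟩
      exact (h1 s hX hY e he a ha).arrow (h2 s hX hY e he b hb) _
        (arrowF_map_step_le ((interp σ).map e) ((interp τ).map e) ha b)
    · exact fun x y z hx hy hz => hx.isLUB hy (EP.isLUB_emb ((interp (.arrow σ τ)).map e) hz)
  | @mu n τ h =>
    obtain rfl : (fun i => sem (s i)) = Y := funext hY
    obtain ⟨m, x, hx, rfl⟩ := exists_compact_of_bilim hd
    let G := consF n ⋙ interp τ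
    let inj := bilimIn (Functor.ofSequence (iterStep G (fun i => sem (s i))))
    -- The inner induction on stages: stage `m` over `X` is mapped to stage `m` over the closed
    -- types, then into the recursive type.
    have key : ∀ m (x : iterObj G X m), IsCompactElement x →
        Definable ((Ty.mu τ).subst s) _ (sem_subst (.mu τ) s _ hY)
          (EP.emb (iterMap G e m ≫ inj m) x) := by
      intro m
      induction m with
      | zero =>
        intro x _
        obtain rfl : x = ⊥ := Subsingleton.elim (α := one) _ _
        rw [EP.emb_bot]
        exact Definable.bot _ _ _
      | succ m ih =>
        intro x hx
        -- In the extended environment the bound variable stands for the substituted recursive type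
        -- itself.
        have hY' : ∀ i : Fin (n + 1), sem (Fin.cases (motive := fun _ => Ty 0)
            ((Ty.mu τ).subst s) s i) = (consF n).obj
              (fun i => sem (s i), (interp (.mu τ)).obj fun i => sem (s i)) i := fun i => by
          refine Fin.cases (sem_subst (.mu τ) s _ hY) hY i
        refine foldDefinable_subst τ s _
          ((congrArg sem (Ty.unfolding_subst τ s)).trans (sem_subst τ _ _ hY')) m
          (EP.emb (iterMap G e (m + 1)) x) ?_
        -- The bound variable is assigned stage `m`, and `ih` is exactly the assumption about
        -- compact elements required there.
        have h3 := h _ (X := (consF n).obj (X, iterObj G X m))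
          (fun i => by
            refine Fin.cases (isScottDomain_iterObj (isScottDomain_interp τ) hX m) hX i) hY'
          ((consF n).map (Prod.mkHom e (iterMap G e m ≫ inj m)))
          (fun i => by refine Fin.cases ih he i) x hx
        have h4 := Definable.congr_type (Ty.unfolding_subst τ s).symm h3
        -- Functoriality splits the embedding of `h3` into the stage map at `m + 1` followed by `G`
        -- of the `m`-th injection, the form that `foldDefinable_subst` accepts.
        have h5 := G.map_comp
          (Prod.mkHom e (iterMap G e m)) (Prod.mkHom (𝟙 _) (inj m))
        rw [show Prod.mkHom e (iterMap G e m) ≫ Prod.mkHom (𝟙 _) (inj m) =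
            Prod.mkHom e (iterMap G e m ≫ inj m) from
          Prod.ext (Category.comp_id e) rfl] at h5
        exact (congrArg (Definable _ _ _) (congrArg (fun f => EP.emb f x) h5)).mp h4
    -- Naturality of the stage injections turns the image of the embedded `x` into the element
    -- treated by `key`.
    have h2 := congrArg (fun f => EP.emb f x)
      (bilimIn_comp_map ((iterChain G).map e) m)
    exact (congrArg (Definable _ _ (sem_subst (.mu τ) s _ hY)) h2).mpr (key m x hx)

theorem exists_form_of_compact (τ : Ty 0) (d : sem τ) (hd : IsCompactElement d) :
    ∃ δ : Form τ, Set.Ici d = δ.sem := by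
  -- With no free variables the assumptions on the environment are vacuous, and the identity serves
  -- as the embedding.
  have h := definable_map τ Ty.var (X := fun i => i.elim0) (Y := fun i => i.elim0)
    (fun i => i.elim0) (fun i => i.elim0) (𝟙 _) (fun i => i.elim0) d hd
  rw [CategoryTheory.Functor.map_id] at h
  exact h.congr_type (Ty.subst_var τ)

end DomainLogic

theorem mainTheorem8 (τ : DomainLogic.Ty 0) :
    (∀ δ : DomainLogic.Form τ, δ.sem.Nonempty →
      ∃ d : DomainLogic.sem τ, IsCompactElement d ∧ δ.sem = Set.Ici d) ∧
    (∀ d : DomainLogic.sem τ, IsCompactElement d →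
      ∃ δ : DomainLogic.Form τ, Set.Ici d = δ.sem) :=
  ⟨fun δ => δ.exists_compact, DomainLogic.exists_form_of_compact τ⟩
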